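/- A \emph{polyhedral map} on a closed surface $M$ is a finite decomposition of $M$ into vertices, edges and faces, in which each face is a $p$-gon for some $p\ge 3$ (a closed disc bounded by a cycle of $p$ distinct vertices) and any two distinct faces are disjoint or meet in exactly one vertex or exactly one edge. It is \emph{semi-equivelar of type} $[p_1^{n_1},\dots,p_k^{n_k}]$ (where $p_i\neq p_{i+1}$ with indices modulo $k$ if $k\geq 2$) if around every vertex the faces containing that vertex form, in cyclic order (up to the choice of the starting face and of the direction), a sequence of $n_1$ $p_1$-gons, followed by $n_2$ $p_2$-gons, \dots, followed by $n_k$ $p_k$-gons. It is \emph{vertex-transitive} if its automorphism group (the permutations of the vertices that map boundary cycles of faces to boundary cycles of faces) acts transitively on the vertices. \textbf{Theorem.} For each of the ten types $[3^6]$, $[6^3]$, $[4^4]$, $[3^3,4^2]$, $[3^2,4^1,3^1,4^1]$, $[3^1,6^1,3^1,6^1]$, $[3^1,4^1,6^1,4^1]$, $[3^1,12^2]$, $[4^1,8^2]$, $[4^1,6^1,12^1]$ there exists a semi-equivelar map of that type on the Klein bottle which is not vertex-transitive. -/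

import Mathlib

/-- The edge set `C` is an `n`-gon: the cycle `c 0 - c 1 - ⋯ - c (n-1) - c 0` on `n ≥ 3` distinct
vertices.  (`finRotate n` is the cyclic successor `i ↦ i + 1` on `Fin n`.)  An `n`-gon is recorded
by its set of edges, so it carries neither a base point nor a direction. -/
def IsPolygon {V : Type*} (n : ℕ) (C : Finset (Sym2 V)) : Prop :=
  3 ≤ n ∧ ∃ c : Fin n → V, Function.Injective c ∧
    ∀ e : Sym2 V, e ∈ C ↔ ∃ i : Fin n, e = s(c i, c (finRotate n i))

/-- The vertices of a polygon given by its edges. -/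
def polygonVertices {V : Type*} (C : Finset (Sym2 V)) : Set V :=
  {v | ∃ e ∈ C, v ∈ e}

/-- `A 0 - A 1 - ⋯ - A (d-1) - A 0` is the face-cycle of the vertex `v` in the collection `faces`
of polygons: the `A i` are the faces containing `v`, each listed once, and there are distinct
neighbours `w 0, …, w (d-1)` of `v` such that `A i` contains the edges `v w_i` and `v w_{i+1}`.
So the consecutive faces `A i` and `A (i+1)` share the edge `v w_{i+1}`. -/
def IsFaceCycle {V : Type*} (faces : Finset (Finset (Sym2 V))) (v : V) {d : ℕ}
    (A : Fin d → Finset (Sym2 V)) : Prop :=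
  3 ≤ d ∧ Function.Injective A ∧
    (∀ C, (C ∈ faces ∧ v ∈ polygonVertices C) ↔ ∃ i, A i = C) ∧
    ∃ w : Fin d → V, Function.Injective w ∧
      ∀ i, s(v, w i) ∈ A i ∧ s(v, w (finRotate d i)) ∈ A i

/-- A (finite) polyhedral map with vertex set `V`.  Faces are identified with their boundary
cycles.  Two distinct faces meet in nothing, in one vertex or in one edge, and the faces around
each vertex form a cycle. -/
structure PolyhedralMap (V : Type*) where
  faces : Finset (Finset (Sym2 V))
  polygon : ∀ C ∈ faces, ∃ n, IsPolygon n C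
  inter : ∀ C ∈ faces, ∀ D ∈ faces, C ≠ D →
    polygonVertices C ∩ polygonVertices D = ∅ ∨
    (∃ v, polygonVertices C ∩ polygonVertices D = {v}) ∨
    (∃ u v, s(u, v) ∈ C ∧ s(u, v) ∈ D ∧ polygonVertices C ∩ polygonVertices D = {u, v})
  link : ∀ v : V, ∃ (d : ℕ) (A : Fin d → Finset (Sym2 V)), IsFaceCycle faces v A

namespace PolyhedralMap

variable {V : Type*} (X : PolyhedralMap V)

open Classical in
/-- The geometric carrier of `X`: each face `C` is realised as a polygonal disc, namely the cone
over its boundary cycle from a centre of its own, that is, as the union of the triangles spanned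
by the centre of `C` and an edge of `C`; these discs are glued along common vertices and edges.
It is a subspace of the Euclidean space whose coordinates are indexed by vertices and faces. -/
def carrier : Set (V ⊕ X.faces → ℝ) :=
  {x | ∃ (C : X.faces) (u v : V), s(u, v) ∈ C.1 ∧
    x ∈ convexHull ℝ {Pi.single (Sum.inl u) (1 : ℝ), Pi.single (Sum.inl v) (1 : ℝ),
      Pi.single (Sum.inr C) (1 : ℝ)}}

/-- `X` is a map on the surface `M`. -/
def IsMapOn (M : Type*) [TopologicalSpace M] : Prop :=
  Nonempty (X.carrier ≃ₜ M)

/-- Automorphisms of `X`: the permutations of the vertices that carry faces to faces. -/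
def IsAut (σ : Equiv.Perm V) : Prop :=
  ∀ C : Finset (Sym2 V), C ∈ X.faces ↔ C.map σ.toEmbedding.sym2Map ∈ X.faces

/-- The automorphism group acts transitively on the vertices. -/
def VertexTransitive : Prop :=
  ∀ u v : V, ∃ σ : Equiv.Perm V, X.IsAut σ ∧ σ u = v

/-- `[p₁^{n₁}, …, p_k^{n_k}]`, given as the list of the pairs `(p_i, n_i)`, written out as a
sequence of face sizes: `n₁` times `p₁`, then `n₂` times `p₂`, and so on. -/
def expandType (τ : List (ℕ × ℕ)) : List ℕ :=
  τ.flatMap fun q => List.replicate q.2 q.1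

/-- `X` is semi-equivelar of type `τ = [p₁^{n₁}, …, p_k^{n_k}]`: the face-cycle of every vertex,
started and directed suitably, consists of `n₁` `p₁`-gons, followed by `n₂` `p₂`-gons, …, followed
by `n_k` `p_k`-gons. -/
def IsSemiEquivelarOfType (τ : List (ℕ × ℕ)) : Prop :=
  ∀ v : V, ∃ A : Fin (expandType τ).length → Finset (Sym2 V),
    IsFaceCycle X.faces v A ∧ ∀ i, IsPolygon ((expandType τ).get i) (A i)

end PolyhedralMap

/-- The side identifications of the unit square that produce the Klein bottle:
`(0, y) ∼ (1, y)` and `(x, 0) ∼ (1 - x, 1)`. -/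
inductive KleinGlue : unitInterval × unitInterval → unitInterval × unitInterval → Prop
  | parallel (y : unitInterval) : KleinGlue (0, y) (1, y)
  | reversed (x : unitInterval) : KleinGlue (x, 0) (unitInterval.symm x, 1)

/-- The Klein bottle, with the quotient topology of the unit square. -/
abbrev KleinBottle : Type := Quot KleinGlue

/-- `[3^6]`, `[6^3]`, `[4^4]`, `[3^3,4^2]`, `[3^2,4^1,3^1,4^1]`, `[3^1,6^1,3^1,6^1]`,
`[3^1,4^1,6^1,4^1]`, `[3^1,12^2]`, `[4^1,8^2]`, `[4^1,6^1,12^1]`. -/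
def kleinBottleTypes : List (List (ℕ × ℕ)) :=
  [[(3, 6)], [(6, 3)], [(4, 4)], [(3, 3), (4, 2)], [(3, 2), (4, 1), (3, 1), (4, 1)],
   [(3, 1), (6, 1), (3, 1), (6, 1)], [(3, 1), (4, 1), (6, 1), (4, 1)], [(3, 1), (12, 2)],
   [(4, 1), (8, 2)], [(4, 1), (6, 1), (12, 1)]]

open Set

/-!
Every type is realised by an explicit quotient of an Archimedean tiling by a glide reflection and a
translation orthogonal to it, given by the list of its faces (9 to 54 vertices). Three things have
to be verified about such a list.

*The surface.* The carrier of a polyhedral map is the realization, in barycentric coordinates, of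
the simplicial complex whose triangles are spanned by the centre and an edge of a face
(`carrier_eq_realization`). A stellar subdivision at a simplex `s` has an explicit effect on
barycentric coordinates: the part `min_s y` common to the vertices of `s` is transferred to the new
vertex (`homeoRealizations_stellar`). Two complexes with a common stellar subdivision have
homeomorphic realizations, which covers the exchange of the diagonal in a quadrangle and the removal
of a vertex of degree three. These combine to the contraction of an edge `m a` whose end points
have no common neighbours besides the two forced ones (`homeoRealizations_contract`). In this way
the complex of each of the ten maps is reduced to one fixed triangulation `gridKlein` of the Klein
bottle with nine vertices. For the latter, the barycentric coordinates as functions on the square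
induce a continuous bijection from the Klein bottle, which is compact, onto the realization, which
is Hausdorff (`nonempty_gridKlein_homeomorph_kleinBottle`).

*The faces.* That the faces meet properly, and that around each vertex they form a cycle of the
prescribed type, are finite conditions on the list (`IsPolygonList`, `IsSemiEquivelarList`).

*No transitivity.* An automorphism preserves edges, hence the number of vertices that are reached
from a vertex by walks of length `k`. In each of the maps this number differs at two vertices for a
suitable `k` (`not_vertexTransitive_of_ncard_walkEnds_ne`).

The finite conditions are decided by evaluation in the kernel.
-/

/-! ### Realizations and stellar subdivision -/

/-- The geometric realization of the simplicial complex whose maximal simplices are the members of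
`K`, by barycentric coordinates. -/
def realization {W : Type*} (K : Set (Finset W)) : Set (W → ℝ) :=
  {x | (∀ w, 0 ≤ x w) ∧ ∃ t ∈ K, (∀ w, w ∉ t → x w = 0) ∧ ∑ w ∈ t, x w = 1}

/-- The complexes generated by `K` and `K'` have homeomorphic realizations. -/
def HomeoRealizations {W W' : Type*} (K : Set (Finset W)) (K' : Set (Finset W')) : Prop :=
  Nonempty (realization K ≃ₜ realization K')

theorem HomeoRealizations.symm {W W' : Type*} {K : Set (Finset W)} {K' : Set (Finset W')}
    (h : HomeoRealizations K K') : HomeoRealizations K' K :=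
  h.map Homeomorph.symm

theorem HomeoRealizations.trans {W W' W'' : Type*} {K : Set (Finset W)} {K' : Set (Finset W')}
    {K'' : Set (Finset W'')} (h : HomeoRealizations K K') (h' : HomeoRealizations K' K'') :
    HomeoRealizations K K'' :=
  ⟨h.some.trans h'.some⟩

theorem HomeoRealizations.refl {W : Type*} (K : Set (Finset W)) : HomeoRealizations K K :=
  ⟨Homeomorph.refl _⟩

theorem Finset.inf'_eq_zero_of_nonneg {W : Type*} {s : Finset W} {hs : s.Nonempty} {y : W → ℝ}
    (h0 : ∀ w, 0 ≤ y w) {v : W} (hv : v ∈ s) (hyv : y v = 0) : s.inf' hs y = 0 :=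
  le_antisymm (hyv ▸ Finset.inf'_le y hv) (Finset.le_inf' hs y fun w _ => h0 w)

section Stellar

variable {W : Type*} [DecidableEq W]

/-- The stellar subdivision of `K` at the simplex `s`, with new vertex `m`: every simplex `t`
containing `s` is replaced by the simplices obtained from it by exchanging a vertex of `s`
for `m`. -/
def stellar (K : Set (Finset W)) (s : Finset W) (m : W) : Set (Finset W) :=
  {t | (t ∈ K ∧ ¬ s ⊆ t) ∨ ∃ t' ∈ K, s ⊆ t' ∧ ∃ v ∈ s, t = insert m (t'.erase v)}

/-- Barycentric coordinates after a stellar subdivision: the part of `y` that is spread evenly over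
`s` is moved to the new vertex `m`. -/
noncomputable def stellarCoord (s : Finset W) (hs : s.Nonempty) (m : W) (y : W → ℝ) : W → ℝ :=
  fun w => if w = m then s.card * s.inf' hs y else if w ∈ s then y w - s.inf' hs y else y w

/-- The inverse of `stellarCoord`: the new vertex `m` is placed at the barycentre of `s`. -/
noncomputable def unstellarCoord (s : Finset W) (m : W) (x : W → ℝ) : W → ℝ :=
  fun w => if w = m then 0 else if w ∈ s then x w + x m / s.card else x w

theorem continuous_stellarCoord (s : Finset W) (hs : s.Nonempty) (m : W) :
    Continuous (stellarCoord s hs m) := by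
  have h : Continuous fun y : W → ℝ => s.inf' hs y :=
    Continuous.finset_inf'_apply hs fun i _ => continuous_apply i
  refine continuous_pi fun w => ?_
  unfold stellarCoord
  split_ifs <;> fun_prop

theorem continuous_unstellarCoord (s : Finset W) (m : W) : Continuous (unstellarCoord s m) := by
  refine continuous_pi fun w => ?_
  unfold unstellarCoord
  split_ifs <;> fun_prop

theorem stellarCoord_mem {K : Set (Finset W)} {s : Finset W} (hs : s.Nonempty) {m : W}
    (hms : m ∉ s) (hmK : ∀ t ∈ K, m ∉ t) {y : W → ℝ} (hy : y ∈ realization K) :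
    stellarCoord s hs m y ∈ realization (stellar K s m) := by
  obtain ⟨h0, t, ht, hsupp, hsum⟩ := hy
  have hm0 : y m = 0 := hsupp m (hmK t ht)
  refine ⟨fun w => ?_, ?_⟩
  · have : 0 ≤ s.inf' hs y := Finset.le_inf' hs y fun w _ => h0 w
    unfold stellarCoord
    split_ifs with h1 h2
    · positivity
    · linarith [Finset.inf'_le y h2]
    · exact h0 w
  by_cases hst : s ⊆ t
  · -- the coordinate of a vertex `v` that attains the minimum becomes zero
    obtain ⟨v, hv, hvmin⟩ := Finset.exists_mem_eq_inf' hs y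
    have hvm : v ≠ m := fun h => hms (h ▸ hv)
    refine ⟨insert m (t.erase v), Or.inr ⟨t, ht, hst, v, hv, rfl⟩, fun w hw => ?_, ?_⟩
    · simp only [Finset.mem_insert, Finset.mem_erase, not_or, not_and_or, not_not] at hw
      unfold stellarCoord
      rw [if_neg hw.1]
      rcases hw.2 with rfl | h
      · rw [if_pos hv, hvmin, sub_self]
      · rw [if_neg (fun h' => h (hst h')), hsupp w h]
    · rw [Finset.sum_insert (by simp [hmK t ht])]
      have hz : stellarCoord s hs m y v = 0 := by
        unfold stellarCoord; rw [if_neg hvm, if_pos hv, hvmin, sub_self]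
      rw [Finset.sum_erase _ hz]
      have hcongr : ∑ w ∈ t, stellarCoord s hs m y w
          = ∑ w ∈ t, (y w - if w ∈ s then s.inf' hs y else 0) := by
        refine Finset.sum_congr rfl fun w hw => ?_
        have : w ≠ m := fun h => hmK t ht (h ▸ hw)
        unfold stellarCoord
        rw [if_neg this]
        split_ifs <;> simp
      rw [hcongr, Finset.sum_sub_distrib, hsum, ← Finset.sum_filter,
        Finset.filter_mem_eq_inter, Finset.inter_eq_right.2 hst]
      simp [stellarCoord]
  · obtain ⟨v, hv, hvt⟩ := Finset.not_subset.1 hst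
    have hmin : s.inf' hs y = 0 := Finset.inf'_eq_zero_of_nonneg h0 hv (hsupp v hvt)
    have hid : stellarCoord s hs m y = y := by
      funext w
      unfold stellarCoord
      split_ifs with h1 h2 <;> simp [hmin, h1, hm0]
    rw [hid]
    exact ⟨t, Or.inl ⟨ht, hst⟩, hsupp, hsum⟩

theorem unstellarCoord_mem {K : Set (Finset W)} {s : Finset W} (hs : s.Nonempty) {m : W}
    (hms : m ∉ s) (hmK : ∀ t ∈ K, m ∉ t) {x : W → ℝ} (hx : x ∈ realization (stellar K s m)) :
    unstellarCoord s m x ∈ realization K ∧ s.inf' hs x = 0 := by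
  obtain ⟨h0, t, ht, hsupp, hsum⟩ := hx
  have h0' : ∀ w, 0 ≤ unstellarCoord s m x w := by
    intro w
    unfold unstellarCoord
    split_ifs
    · exact le_rfl
    · have := h0 m
      have := h0 w
      positivity
    · exact h0 w
  rcases ht with ⟨ht, hst⟩ | ⟨t, ht, hst, v, hv, rfl⟩
  · have hid : unstellarCoord s m x = x := by
      have hm0 : x m = 0 := hsupp m (hmK t ht)
      funext w
      unfold unstellarCoord
      split_ifs with h1 h2 <;> simp [h1, hm0]
    obtain ⟨v, hv, hvt⟩ := Finset.not_subset.1 hst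
    rw [hid]
    exact ⟨⟨h0, t, ht, hsupp, hsum⟩, Finset.inf'_eq_zero_of_nonneg h0 hv (hsupp v hvt)⟩
  · have hvm : v ≠ m := fun h => hms (h ▸ hv)
    have hxv : x v = 0 := hsupp v (by simp [hvm])
    refine ⟨⟨h0', t, ht, fun w hw => ?_, ?_⟩, Finset.inf'_eq_zero_of_nonneg h0 hv hxv⟩
    · unfold unstellarCoord
      split_ifs with h1 h2
      · rfl
      · exact absurd (hst h2) hw
      · exact hsupp w (by simp [h1, hw])
    · rw [Finset.sum_insert (by simp [hmK t ht]), Finset.sum_erase _ hxv] at hsum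
      have hcongr : ∑ w ∈ t, unstellarCoord s m x w
          = ∑ w ∈ t, (x w + if w ∈ s then x m / s.card else 0) := by
        refine Finset.sum_congr rfl fun w hw => ?_
        have : w ≠ m := fun h => hmK t ht (h ▸ hw)
        unfold unstellarCoord
        rw [if_neg this]
        split_ifs <;> simp
      have hcard : (s.card : ℝ) ≠ 0 := by exact_mod_cast hs.card_ne_zero
      rw [hcongr, Finset.sum_add_distrib, ← Finset.sum_filter,
        Finset.filter_mem_eq_inter, Finset.inter_eq_right.2 hst, Finset.sum_const, nsmul_eq_mul,
        mul_div_cancel₀ _ hcard]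
      linarith

theorem unstellarCoord_stellarCoord {s : Finset W} (hs : s.Nonempty) {m : W} {y : W → ℝ}
    (hm : y m = 0) : unstellarCoord s m (stellarCoord s hs m y) = y := by
  have hcard : (s.card : ℝ) ≠ 0 := by exact_mod_cast hs.card_ne_zero
  funext w
  unfold unstellarCoord stellarCoord
  rw [if_pos (rfl : m = m)]
  split_ifs with h1 h2
  · rw [h1, hm]
  · rw [mul_div_cancel_left₀ _ hcard]; ring
  · rfl

theorem stellarCoord_unstellarCoord {s : Finset W} (hs : s.Nonempty) {m : W} (hms : m ∉ s)
    {x : W → ℝ} (hx : s.inf' hs x = 0) : stellarCoord s hs m (unstellarCoord s m x) = x := by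
  have hcard : (s.card : ℝ) ≠ 0 := by exact_mod_cast hs.card_ne_zero
  have hval : ∀ w ∈ s, unstellarCoord s m x w = x w + x m / s.card := by
    intro w hw
    have : w ≠ m := fun h => hms (h ▸ hw)
    unfold unstellarCoord
    rw [if_neg this, if_pos hw]
  have hmin : s.inf' hs (unstellarCoord s m x) = x m / s.card := by
    obtain ⟨v, hv, hvmin⟩ := Finset.exists_mem_eq_inf' hs x
    apply le_antisymm
    · have := Finset.inf'_le (unstellarCoord s m x) hv
      rw [hval v hv, ← hvmin, hx] at this
      linarith
    · refine Finset.le_inf' hs _ fun w hw => ?_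
      have := Finset.inf'_le x hw
      rw [hval w hw]
      linarith
  funext w
  unfold stellarCoord
  rw [hmin]
  split_ifs with h1 h2
  · rw [mul_div_cancel₀ _ hcard, h1]
  · rw [hval w h2]; ring
  · unfold unstellarCoord
    rw [if_neg h1, if_neg h2]

/-- A stellar subdivision does not change the realization. -/
theorem homeoRealizations_stellar {K : Set (Finset W)} {s : Finset W} (hs : s.Nonempty) {m : W}
    (hms : m ∉ s) (hmK : ∀ t ∈ K, m ∉ t) : HomeoRealizations K (stellar K s m) :=
  ⟨{toFun := fun y => ⟨stellarCoord s hs m y, stellarCoord_mem hs hms hmK y.2⟩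
    invFun := fun x => ⟨unstellarCoord s m x, (unstellarCoord_mem hs hms hmK x.2).1⟩
    left_inv := by
      rintro ⟨y, hy⟩
      obtain ⟨-, t, ht, hsupp, -⟩ := id hy
      exact Subtype.ext (unstellarCoord_stellarCoord hs (hsupp m (hmK t ht)))
    right_inv := by
      rintro ⟨x, hx⟩
      exact Subtype.ext (stellarCoord_unstellarCoord hs hms (unstellarCoord_mem hs hms hmK hx).2)
    continuous_toFun := ((continuous_stellarCoord s hs m).comp continuous_subtype_val).subtype_mk _
    continuous_invFun :=
      ((continuous_unstellarCoord s m).comp continuous_subtype_val).subtype_mk _}⟩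

theorem stellar_union (K K' : Set (Finset W)) (s : Finset W) (m : W) :
    stellar (K ∪ K') s m = stellar K s m ∪ stellar K' s m := by
  ext t
  simp only [stellar, mem_ofPred_eq, mem_union]
  grind

theorem stellar_eq_self {K : Set (Finset W)} {s : Finset W} (h : ∀ t ∈ K, ¬ s ⊆ t) (m : W) :
    stellar K s m = K := by
  ext t
  simp only [stellar, mem_ofPred_eq]
  grind

theorem stellar_singleton {t s : Finset W} (h : s ⊆ t) (m : W) :
    stellar {t} s m = {t' | ∃ v ∈ s, t' = insert m (t.erase v)} := by
  ext t'
  simp only [stellar, mem_ofPred_eq, mem_singleton_iff]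
  grind

/-- Removal of a vertex `m` of degree three. -/
theorem homeoRealizations_remove {R : Set (Finset W)} {m a b c : W} (hab : a ≠ b) (hac : a ≠ c)
    (hbc : b ≠ c) (ham : a ≠ m) (hbm : b ≠ m) (hcm : c ≠ m) (hmR : ∀ t ∈ R, m ∉ t)
    (hR : ∀ t ∈ R, ¬ (a ∈ t ∧ b ∈ t ∧ c ∈ t)) :
    HomeoRealizations (R ∪ {{m, a, b}, {m, b, c}, {m, c, a}}) (R ∪ {{a, b, c}}) := by
  have hs : ({a, b, c} : Finset W).Nonempty := ⟨a, by simp⟩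
  have key := homeoRealizations_stellar (K := R ∪ {{a, b, c}}) hs (m := m)
    (by simp [ham.symm, hbm.symm, hcm.symm])
    (by
      rintro t (ht | rfl)
      · exact hmR t ht
      · simp [ham.symm, hbm.symm, hcm.symm])
  rw [stellar_union, stellar_eq_self (by
    intro t ht hst
    exact hR t ht ⟨hst (by simp), hst (by simp), hst (by simp)⟩),
    stellar_singleton (Finset.Subset.refl _)] at key
  convert key.symm using 2
  ext t
  have h1 : ({a, b, c} : Finset W).erase a = {b, c} := by grind
  have h2 : ({a, b, c} : Finset W).erase b = {c, a} := by grind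
  have h3 : ({a, b, c} : Finset W).erase c = {a, b} := by grind
  simp only [mem_insert_iff, mem_singleton_iff, mem_ofPred_eq, Finset.mem_insert,
    Finset.mem_singleton, exists_eq_or_imp, exists_eq_left, h1, h2, h3]
  tauto

/-- The exchange of the diagonal `b c` for the diagonal `a d` in the quadrangle `a b d c`: both
complexes have the same stellar subdivision at the diagonal. -/
theorem homeoRealizations_flip [Infinite W] {R : Set (Finset W)} (hfin : R.Finite) {a b c d : W}
    (hab : a ≠ b) (hac : a ≠ c) (had : a ≠ d) (hbc : b ≠ c) (hbd : b ≠ d) (hcd : c ≠ d)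
    (hRbc : ∀ t ∈ R, ¬ (b ∈ t ∧ c ∈ t)) (hRad : ∀ t ∈ R, ¬ (a ∈ t ∧ d ∈ t)) :
    HomeoRealizations (R ∪ {{b, a, c}, {b, c, d}}) (R ∪ {{b, a, d}, {a, c, d}}) := by
  -- a vertex `m` that is not yet in use
  obtain ⟨m, hm⟩ : ∃ m, m ∉ hfin.toFinset.biUnion id ∪ {a, b, c, d} :=
    Infinite.exists_notMem_finset _
  simp only [Finset.mem_union, Finset.mem_biUnion, Set.Finite.mem_toFinset, id, Finset.mem_insert,
    Finset.mem_singleton, not_or, not_exists, not_and] at hm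
  obtain ⟨hmR, hma, hmb, hmc, hmd⟩ := hm
  have key1 := homeoRealizations_stellar (K := R ∪ {{b, a, c}, {b, c, d}}) (s := {b, c})
    ⟨b, by simp⟩ (m := m) (by simp [hmb, hmc])
    (by rintro t (ht | rfl | rfl); exacts [hmR t ht, by simp [*], by simp [*]])
  have key2 := homeoRealizations_stellar (K := R ∪ {{b, a, d}, {a, c, d}}) (s := {a, d})
    ⟨a, by simp⟩ (m := m) (by simp [hma, hmd])
    (by rintro t (ht | rfl | rfl); exacts [hmR t ht, by simp [*], by simp [*]])
  refine key1.trans (HomeoRealizations.symm ?_)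
  convert key2 using 1
  rw [stellar_union, stellar_union,
    stellar_eq_self (K := R) fun t ht h => hRbc t ht ⟨h (by simp), h (by simp)⟩,
    stellar_eq_self (K := R) fun t ht h => hRad t ht ⟨h (by simp), h (by simp)⟩]
  · congr 1
    rw [Set.insert_eq, Set.insert_eq, stellar_union, stellar_union,
      stellar_singleton, stellar_singleton, stellar_singleton, stellar_singleton]
    · ext t
      have h1 : ({b, a, c} : Finset W).erase b = {a, c} := by grind
      have h2 : ({b, a, c} : Finset W).erase c = {a, b} := by grind
      have h3 : ({b, c, d} : Finset W).erase b = {c, d} := by grind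
      have h4 : ({b, c, d} : Finset W).erase c = {b, d} := by grind
      have h5 : ({b, a, d} : Finset W).erase a = {b, d} := by grind
      have h6 : ({b, a, d} : Finset W).erase d = {a, b} := by grind
      have h7 : ({a, c, d} : Finset W).erase a = {c, d} := by grind
      have h8 : ({a, c, d} : Finset W).erase d = {a, c} := by grind
      simp only [mem_union, mem_ofPred_eq, Finset.mem_insert,
        Finset.mem_singleton, exists_eq_or_imp, exists_eq_left, h1, h2, h3, h4, h5, h6, h7, h8]
      tauto
    all_goals simp [Finset.insert_subset_iff]

end Stellar

/-! ### Contraction of edges -/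

section Contraction

variable {W : Type*} [DecidableEq W]

/-- The triangles spanned by `v` and the edges of the path `l`. -/
def fan (v : W) : List W → Set (Finset W)
  | x :: y :: l => insert {v, x, y} (fan v (y :: l))
  | _ => ∅

theorem finite_fan (v : W) : ∀ l : List W, (fan v l).Finite
  | [] => by simp [fan]
  | [_] => by simp [fan]
  | x :: y :: l => by
    rw [fan]
    exact (finite_fan v (y :: l)).insert _

theorem eq_or_mem_of_mem_fan {v w : W} {t : Finset W} (hw : w ∈ t) :
    ∀ {l : List W}, t ∈ fan v l → w = v ∨ w ∈ l
  | [], h => by simp [fan] at h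
  | [_], h => by simp [fan] at h
  | x :: y :: l, h => by
    rcases h with rfl | h
    · simp at hw
      grind
    · have := eq_or_mem_of_mem_fan hw h
      grind

/-- Contraction of the edge `m a`: if the link of `m` is the cycle `a, p, …, q` and `a` has no
further neighbours on this cycle, then the star of `m` may be replaced by the fan from `a` over the
path `p, …, q`.  Flipping the edges from `m` to the path one after the other makes `m` a vertex of
degree three. -/
theorem homeoRealizations_contract [Infinite W] {m a q : W} (mid : List W) :
    ∀ {p : W} {R : Set (Finset W)}, R.Finite → (m :: a :: p :: (mid ++ [q])).Nodup →
    (∀ t ∈ R, m ∉ t) → (∀ x ∈ mid, ∀ t ∈ R, ¬ (a ∈ t ∧ x ∈ t)) →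
    (∀ t ∈ R, ¬ (a ∈ t ∧ p ∈ t ∧ q ∈ t)) →
    HomeoRealizations (R ∪ fan m (a :: p :: (mid ++ [q, a]))) (R ∪ fan a (p :: (mid ++ [q]))) := by
  induction mid with
  | nil =>
    intro p R hfin hnd hmR hmid hR
    have := homeoRealizations_remove (R := R) (m := m) (a := a) (b := p) (c := q)
      (by grind) (by grind) (by grind) (by grind) (by grind) (by grind) hmR hR
    simpa [fan] using this
  | cons x r ih =>
    intro p R hfin hnd hmR hmid hR
    -- the path from `x` back to `a`, and its first vertex after `x`
    obtain ⟨y, l, hyl⟩ : ∃ y l, r ++ [q, a] = y :: l := by cases r <;> simp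
    have hsub : ∀ w ∈ y :: l, w ∈ r ∨ w = q ∨ w = a := by
      intro w hw; rw [← hyl] at hw; simpa using hw
    have hya : y ≠ a := by
      cases r <;> simp at hyl <;> grind
    -- the edge `m p` is flipped to `a x`; then the induction hypothesis applies to the shorter link
    have h1 := homeoRealizations_flip (R := R ∪ fan m (x :: y :: l)) (hfin.union (finite_fan _ _))
      (a := a) (b := m) (c := p) (d := x)
      (by grind) (by grind) (by grind) (by grind) (by grind) (by grind)
      (by
        rintro t (ht | ht) ⟨hm, hp⟩
        · exact hmR t ht hm
        · have := eq_or_mem_of_mem_fan hp ht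
          grind)
      (by
        rintro t (ht | rfl | ht) ⟨ha, hx⟩
        · exact hmid x (by simp) t ht ⟨ha, hx⟩
        · simp at ha
          grind
        · have := eq_or_mem_of_mem_fan hx ht
          grind)
    have h2 := ih (p := x) (R := insert {a, p, x} R) (hfin.insert _) (by grind)
      (by
        rintro t (rfl | ht)
        · simp; grind
        · exact hmR t ht)
      (by
        rintro w hw t (rfl | ht) ⟨ha, hx⟩
        · simp at hx; grind
        · exact hmid w (by simp [hw]) t ht ⟨ha, hx⟩)
      (by
        rintro t (rfl | ht) ⟨ha, hx, hq⟩
        · simp at hq; grind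
        · exact hmid x (by simp) t ht ⟨ha, hx⟩)
    have e1 : R ∪ fan m (a :: p :: (x :: r ++ [q, a]))
        = R ∪ fan m (x :: y :: l) ∪ {{m, a, p}, {m, p, x}} := by
      rw [List.cons_append, hyl]
      ext t; simp only [fan, mem_union, mem_insert_iff, mem_singleton_iff]; tauto
    have e2 : R ∪ fan m (x :: y :: l) ∪ {{m, a, x}, {a, p, x}}
        = insert {a, p, x} R ∪ fan m (a :: x :: (r ++ [q, a])) := by
      rw [hyl]
      ext t; simp only [fan, mem_union, mem_insert_iff, mem_singleton_iff]; tauto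
    have e3 : insert {a, p, x} R ∪ fan a (x :: (r ++ [q]))
        = R ∪ fan a (p :: (x :: r ++ [q])) := by
      ext t; simp only [List.cons_append, fan, mem_union, mem_insert_iff]; tauto
    rw [e1, ← e3]
    exact h1.trans (e2 ▸ h2)

end Contraction

/-- The complex given by the list of its maximal simplices, which in turn are given by the lists of
their vertices. -/
def toComplex {W : Type*} [DecidableEq W] (K : List (List W)) : Set (Finset W) :=
  {t | ∃ l ∈ K, l.toFinset = t}

/-- The list form of `fan`. -/
def fanList {W : Type*} (v : W) : List W → List (List W)
  | x :: y :: l => [v, x, y] :: fanList v (y :: l)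
  | _ => []

theorem toComplex_fanList {W : Type*} [DecidableEq W] (v : W) :
    ∀ l : List W, toComplex (fanList v l) = fan v l
  | [] => by simp [fan, fanList, toComplex]
  | [_] => by simp [fan, fanList, toComplex]
  | x :: y :: l => by
    have := toComplex_fanList v (y :: l)
    ext t
    simp [fan, fanList, ← this, toComplex, eq_comm]

theorem toComplex_append {W : Type*} [DecidableEq W] (K K' : List (List W)) :
    toComplex (K ++ K') = toComplex K ∪ toComplex K' := by
  ext t
  simp [toComplex, or_and_right, exists_or]

theorem finite_toComplex {W : Type*} [DecidableEq W] (K : List (List W)) :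
    (toComplex K).Finite := by
  have : toComplex K = (K.map List.toFinset).toFinset := by
    ext t; simp [toComplex]
  rw [this]
  exact Finset.finite_toSet _

/-- Two lists of simplices list the same simplices. -/
def SameSimplices {W : Type*} (K K' : List (List W)) : Prop :=
  (∀ s ∈ K, ∃ t ∈ K', s ⊆ t ∧ t ⊆ s) ∧ ∀ t ∈ K', ∃ s ∈ K, s ⊆ t ∧ t ⊆ s

instance {W : Type*} [DecidableEq W] (K K' : List (List W)) : Decidable (SameSimplices K K') :=
  inferInstanceAs (Decidable (_ ∧ _))

theorem SameSimplices.toComplex_eq {W : Type*} [DecidableEq W] {K K' : List (List W)}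
    (h : SameSimplices K K') : toComplex K = toComplex K' := by
  have aux : ∀ {s t : List W}, s ⊆ t → t ⊆ s → s.toFinset = t.toFinset := by
    intro s t h1 h2
    ext w
    simpa using ⟨fun h => h1 h, fun h => h2 h⟩
  ext u
  constructor
  · rintro ⟨s, hs, rfl⟩
    obtain ⟨t, ht, h1, h2⟩ := h.1 s hs
    exact ⟨t, ht, aux h2 h1⟩
  · rintro ⟨t, ht, rfl⟩
    obtain ⟨s, hs, h1, h2⟩ := h.2 t ht
    exact ⟨s, hs, aux h1 h2⟩

/-- The path that starts at `v` and uses in each step the first of the edges `E` that contains the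
current vertex and has not been used.  The starting point is not listed; the first argument bounds
the length. -/
def trail : ℕ → List (List ℕ) → ℕ → List ℕ
  | 0, _, _ => []
  | k + 1, E, v =>
    match E.find? (v ∈ ·) with
    | none => []
    | some e => match e.filter (· ≠ v) with
      | [] => []
      | w :: _ => w :: trail k (E.erase e) w

/-- The list of triangles obtained from `K` by contracting the edge `m a` to `a`, provided that the
link of `m` is a cycle through `a` and that the triangles off `m` make `a` adjacent to its two
neighbours on this cycle only (but do not span a triangle with these). -/
def contract (K : List (List ℕ)) (m a : ℕ) : Option (List (List ℕ)) :=
  let S := K.filter (m ∈ ·)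
  let R := K.filter (m ∉ ·)
  match (trail S.length (S.map (List.filter (· ≠ m))) a).dropLast with
  | [] => none
  | p :: l =>
    match l.getLast? with
    | none => none
    | some q =>
      if (m :: a :: p :: l).Nodup ∧ SameSimplices S (fanList m (a :: p :: (l ++ [a]))) ∧
          ∀ t ∈ R, a ∈ t → (∀ x ∈ l.dropLast, x ∉ t) ∧ (p ∈ t → q ∉ t) then
        some (fanList a (p :: l) ++ R)
      else none

theorem homeoRealizations_of_contract_eq_some {K K' : List (List ℕ)} {m a : ℕ}
    (h : contract K m a = some K') : HomeoRealizations (toComplex K) (toComplex K') := by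
  unfold contract at h
  extract_lets S R at h
  split at h
  · simp at h
  rename_i p l hl
  split at h
  · simp at h
  rename_i q hq
  split_ifs at h with hc
  obtain ⟨hnd, hS, hR⟩ := hc
  simp only [Option.some.injEq] at h
  have hlq : l = l.dropLast ++ [q] := (List.dropLast_append_getLast? q hq).symm
  have hK : toComplex K = toComplex R ∪ fan m (a :: p :: (l.dropLast ++ [q, a])) := by
    have e : l.dropLast ++ [q, a] = l ++ [a] := by
      conv_rhs => rw [hlq]
      simp
    rw [e, ← toComplex_fanList, ← hS.toComplex_eq]
    ext t
    simp only [toComplex, mem_union, mem_ofPred_eq, S, R, List.mem_filter, decide_eq_true_eq]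
    constructor
    · rintro ⟨s, hs, rfl⟩
      by_cases hm : m ∈ s
      · exact Or.inr ⟨s, ⟨hs, hm⟩, rfl⟩
      · exact Or.inl ⟨s, ⟨hs, hm⟩, rfl⟩
    · rintro (⟨s, ⟨hs, -⟩, rfl⟩ | ⟨s, ⟨hs, -⟩, rfl⟩) <;> exact ⟨s, hs, rfl⟩
  rw [hK, ← h, toComplex_append, toComplex_fanList, Set.union_comm (fan a _)]
  conv in fan a _ => rw [hlq]
  refine homeoRealizations_contract _ (finite_toComplex R) (by rwa [← hlq]) ?_ ?_ ?_
  · rintro _ ⟨t, ht, rfl⟩ hm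
    simp only [R, List.mem_filter, decide_eq_true_eq] at ht
    exact ht.2 (by simpa using hm)
  · rintro x hx _ ⟨t, ht, rfl⟩ ⟨ha, hx'⟩
    exact (hR t ht (by simpa using ha)).1 x hx (by simpa using hx')
  · rintro _ ⟨t, ht, rfl⟩ ⟨ha, hp, hq'⟩
    exact (hR t ht (by simpa using ha)).2 (by simpa using hp) (by simpa using hq')

/-- Successive contraction of the vertices with the highest labels, down to the vertices `0, …, 8`;
the list gives the vertices to which they are contracted. -/
def contractAll : List ℕ → List (List ℕ) → Option (List (List ℕ))
  | [], K => some K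
  | a :: as, K => (contract K (9 + as.length) a).bind (contractAll as)

theorem homeoRealizations_of_contractAll_eq_some {K' : List (List ℕ)} :
    ∀ {as : List ℕ} {K : List (List ℕ)}, contractAll as K = some K' →
      HomeoRealizations (toComplex K) (toComplex K')
  | [], K, h => by
    simp only [contractAll, Option.some.injEq] at h
    exact h ▸ HomeoRealizations.refl _
  | a :: as, K, h => by
    simp only [contractAll, Option.bind_eq_some_iff] at h
    obtain ⟨K₁, h₁, h₂⟩ := h
    exact (homeoRealizations_of_contract_eq_some h₁).trans
      (homeoRealizations_of_contractAll_eq_some h₂)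

/-! ### The Klein bottle as a triangulated grid -/

/-- Labels of the `3 × 3` grid on the Klein bottle: the vertex in column `k` and row `l`, where
`0 ≤ k, l ≤ 3`.  Columns `0` and `3` agree, and row `3` is row `0` reversed. -/
def gridLabel (k l : ℕ) : ℕ :=
  if l = 3 then (3 - k) % 3 else 3 * l + k % 3

/-- The triangulation of the Klein bottle by the `3 × 3` grid, with the diagonals from the lower
left to the upper right. -/
def gridKlein : List (List ℕ) :=
  (List.range 3).flatMap fun i => (List.range 3).flatMap fun j =>
    [[gridLabel i j, gridLabel (i + 1) j, gridLabel (i + 1) (j + 1)],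
     [gridLabel i j, gridLabel i (j + 1), gridLabel (i + 1) (j + 1)]]

/-- The piecewise linear function on the plane that is `1` at the origin and `0` at all other
lattice points, for the triangulation with diagonals in the direction `(1, 1)`. -/
noncomputable def hexHat (u v : ℝ) : ℝ :=
  max 0 (1 - max (max |u| |v|) |u - v|)

theorem hexHat_of_one_le_left {u v : ℝ} (h : 1 ≤ |u|) : hexHat u v = 0 :=
  max_eq_left (by linarith [le_max_left (max |u| |v|) |u - v|, le_max_left |u| |v|])

theorem hexHat_of_one_le_right {u v : ℝ} (h : 1 ≤ |v|) : hexHat u v = 0 :=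
  max_eq_left (by linarith [le_max_left (max |u| |v|) |u - v|, le_max_right |u| |v|])

theorem hexHat_sub_one_sub_one {s t : ℝ} (hs0 : 0 ≤ s) (ht0 : 0 ≤ t) (hs1 : s ≤ 1) (ht1 : t ≤ 1) :
    hexHat (s - 1) (t - 1) = min s t := by
  unfold hexHat
  rw [abs_of_nonpos (sub_nonpos.2 hs1), abs_of_nonpos (sub_nonpos.2 ht1)]
  grind

theorem hexHat_eq {s t : ℝ} (hs0 : 0 ≤ s) (ht0 : 0 ≤ t) (hs1 : s ≤ 1) (ht1 : t ≤ 1) :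
    hexHat s t = 1 - max s t := by
  unfold hexHat
  rw [abs_of_nonneg hs0, abs_of_nonneg ht0]
  grind

theorem hexHat_sub_one_right {s t : ℝ} (hs0 : 0 ≤ s) (ht0 : 0 ≤ t) (hs1 : s ≤ 1) (ht1 : t ≤ 1) :
    hexHat s (t - 1) = max 0 (t - s) := by
  unfold hexHat
  rw [abs_of_nonneg hs0, abs_of_nonpos (sub_nonpos.2 ht1)]
  grind

theorem hexHat_sub_one_left {s t : ℝ} (hs0 : 0 ≤ s) (ht0 : 0 ≤ t) (hs1 : s ≤ 1) (ht1 : t ≤ 1) :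
    hexHat (s - 1) t = max 0 (s - t) := by
  unfold hexHat
  rw [abs_of_nonneg ht0, abs_of_nonpos (sub_nonpos.2 hs1)]
  grind

/-- The barycentric coordinates, in the triangulated grid, of the point `(x, y)` of the square
`[0, 3] × [0, 3]`. -/
noncomputable def gridCoord (x y : ℝ) : ℕ → ℝ :=
  ∑ k ∈ Finset.range 4, ∑ l ∈ Finset.range 4,
    hexHat (x - k) (y - l) • Pi.single (gridLabel k l) 1

theorem continuous_gridCoord : Continuous fun p : ℝ × ℝ => gridCoord p.1 p.2 := by
  unfold gridCoord
  refine continuous_finsetSum _ fun k _ => continuous_finsetSum _ fun l _ =>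
    Continuous.smul (f := fun p : ℝ × ℝ => hexHat (p.1 - k) (p.2 - l))
      (g := fun _ => Pi.single (gridLabel k l) 1) ?_ continuous_const
  unfold hexHat
  fun_prop

/-- Of a sum over `0, …, 3`, only the terms `i` and `i + 1` remain. -/
theorem sum_range_four_eq {M : Type*} [AddCommMonoid M] {f : ℕ → M} {i : ℕ} (hi : i < 3)
    (h : ∀ k, k ≠ i → k ≠ i + 1 → f k = 0) :
    ∑ k ∈ Finset.range 4, f k = f i + f (i + 1) := by
  rw [← Finset.sum_pair (f := f) (Nat.ne_of_lt (Nat.lt_succ_self i))]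
  refine (Finset.sum_subset ?_ ?_).symm
  · intro k hk; simp at hk ⊢; omega
  · intro k _ hk
    simp only [Finset.mem_insert, Finset.mem_singleton, not_or] at hk
    exact h k hk.1 hk.2

theorem one_le_abs_of_ne {i k : ℕ} {s : ℝ} (h0 : 0 ≤ s) (h1 : s ≤ 1) (hi : k ≠ i)
    (hi' : k ≠ i + 1) : 1 ≤ |(i + s : ℝ) - k| := by
  rcases lt_or_gt_of_ne hi with h | h
  · have : (k : ℝ) + 1 ≤ i := by exact_mod_cast h
    exact le_abs.2 (Or.inl (by linarith))
  · have : (i : ℝ) + 2 ≤ k := by exact_mod_cast (by omega : i + 2 ≤ k)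
    exact le_abs.2 (Or.inr (by linarith))

/-- The coordinates of a point in the cell in column `i` and row `j`. -/
theorem gridCoord_cell {i j : ℕ} (hi : i < 3) (hj : j < 3) {s t : ℝ} (hs0 : 0 ≤ s) (hs1 : s ≤ 1)
    (ht0 : 0 ≤ t) (ht1 : t ≤ 1) :
    gridCoord (i + s) (j + t) =
      ((1 - max s t) • Pi.single (gridLabel i j) 1 +
        max 0 (t - s) • Pi.single (gridLabel i (j + 1)) 1) +
      (max 0 (s - t) • Pi.single (gridLabel (i + 1) j) 1 +
        min s t • Pi.single (gridLabel (i + 1) (j + 1)) 1) := by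
  unfold gridCoord
  rw [sum_range_four_eq hi, sum_range_four_eq hj, sum_range_four_eq hj]
  · simp only [Nat.cast_add, Nat.cast_one, add_sub_cancel_left, add_sub_add_left_eq_sub,
      hexHat_eq hs0 ht0 hs1 ht1, hexHat_sub_one_right hs0 ht0 hs1 ht1,
      hexHat_sub_one_left hs0 ht0 hs1 ht1, hexHat_sub_one_sub_one hs0 ht0 hs1 ht1]
  · intro l h1 h2
    rw [hexHat_of_one_le_right (one_le_abs_of_ne ht0 ht1 h1 h2), zero_smul]
  · intro l h1 h2
    rw [hexHat_of_one_le_right (one_le_abs_of_ne ht0 ht1 h1 h2), zero_smul]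
  · intro k h1 h2
    refine Finset.sum_eq_zero fun l _ => ?_
    rw [hexHat_of_one_le_left (one_le_abs_of_ne hs0 hs1 h1 h2), zero_smul]

theorem gridCoord_lower {i j : ℕ} (hi : i < 3) (hj : j < 3) {s t : ℝ} (hs1 : s ≤ 1) (ht0 : 0 ≤ t)
    (hts : t ≤ s) : gridCoord (i + s) (j + t) =
      (1 - s) • Pi.single (gridLabel i j) 1 + (s - t) • Pi.single (gridLabel (i + 1) j) 1 +
        t • Pi.single (gridLabel (i + 1) (j + 1)) 1 := by
  rw [gridCoord_cell hi hj (ht0.trans hts) hs1 ht0 (hts.trans hs1), max_eq_left hts,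
    max_eq_left (by linarith), max_eq_right (by linarith), min_eq_right hts]
  simp [add_assoc]

theorem gridCoord_upper {i j : ℕ} (hi : i < 3) (hj : j < 3) {s t : ℝ} (hs0 : 0 ≤ s) (ht1 : t ≤ 1)
    (hst : s ≤ t) : gridCoord (i + s) (j + t) =
      (1 - t) • Pi.single (gridLabel i j) 1 + (t - s) • Pi.single (gridLabel i (j + 1)) 1 +
        s • Pi.single (gridLabel (i + 1) (j + 1)) 1 := by
  rw [gridCoord_cell hi hj hs0 (hst.trans ht1) (hs0.trans hst) ht1, max_eq_right hst,
    max_eq_right (by linarith), max_eq_left (by linarith), min_eq_left hst]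
  simp

/-- Every number in `[0, 3]` lies in one of the three unit cells. -/
theorem exists_cell {x : ℝ} (h0 : 0 ≤ x) (h3 : x ≤ 3) :
    ∃ i < 3, ∃ s : ℝ, 0 ≤ s ∧ s ≤ 1 ∧ x = (i : ℕ) + s := by
  rcases le_total x 1 with h | h
  · exact ⟨0, by norm_num, x, h0, h, by simp⟩
  rcases le_total x 2 with h' | h'
  · exact ⟨1, by norm_num, x - 1, by linarith, by linarith, by push_cast; ring⟩
  · exact ⟨2, by norm_num, x - 2, by linarith, by linarith, by push_cast; ring⟩

section Points

variable {W : Type*} [DecidableEq W]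

theorem combination_mem_realization {K : Set (Finset W)} {a b c : W} (hab : a ≠ b) (hac : a ≠ c)
    (hbc : b ≠ c) (hK : {a, b, c} ∈ K) {α β γ : ℝ} (hα : 0 ≤ α) (hβ : 0 ≤ β) (hγ : 0 ≤ γ)
    (h : α + β + γ = 1) :
    α • Pi.single a 1 + β • Pi.single b 1 + γ • Pi.single c 1 ∈ realization K := by
  refine ⟨fun w => ?_, {a, b, c}, hK, fun w hw => ?_, ?_⟩
  · simp only [Pi.add_apply, Pi.smul_apply, Pi.single_apply, smul_eq_mul]
    split_ifs <;> simp <;> positivity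
  · simp only [Finset.mem_insert, Finset.mem_singleton, not_or] at hw
    simp [hw.1, hw.2.1, hw.2.2]
  · rw [Finset.sum_insert (by simp [hab, hac]), Finset.sum_pair hbc]
    simp [hab, hac, hbc, hab.symm, hac.symm, hbc.symm, ← add_assoc, h]

theorem eq_combination {x : W → ℝ} {a b c : W} (hab : a ≠ b) (hac : a ≠ c) (hbc : b ≠ c)
    (hsupp : ∀ w, w ∉ ({a, b, c} : Finset W) → x w = 0) :
    x = x a • Pi.single a 1 + x b • Pi.single b 1 + x c • Pi.single c 1 := by
  funext w
  have := hsupp w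
  simp only [Finset.mem_insert, Finset.mem_singleton] at this
  simp only [Pi.add_apply, Pi.smul_apply, Pi.single_apply, smul_eq_mul]
  grind

end Points

theorem gridLabel_distinct {i j : ℕ} (hi : i < 3) (hj : j < 3) :
    gridLabel i j ≠ gridLabel (i + 1) j ∧ gridLabel i j ≠ gridLabel (i + 1) (j + 1) ∧
    gridLabel (i + 1) j ≠ gridLabel (i + 1) (j + 1) ∧ gridLabel i j ≠ gridLabel i (j + 1) ∧
    gridLabel i (j + 1) ≠ gridLabel (i + 1) (j + 1) := by
  interval_cases i <;> interval_cases j <;> decide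

theorem mem_toComplex_gridKlein {t : Finset ℕ} : t ∈ toComplex gridKlein ↔ ∃ i < 3, ∃ j < 3,
    t = {gridLabel i j, gridLabel (i + 1) j, gridLabel (i + 1) (j + 1)} ∨
    t = {gridLabel i j, gridLabel i (j + 1), gridLabel (i + 1) (j + 1)} := by
  simp only [toComplex, gridKlein, mem_ofPred_eq, List.mem_flatMap, List.mem_range, List.mem_cons,
    List.not_mem_nil, or_false]
  constructor
  · rintro ⟨l, ⟨i, hi, j, hj, rfl | rfl⟩, rfl⟩
    · exact ⟨i, hi, j, hj, Or.inl (by simp)⟩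
    · exact ⟨i, hi, j, hj, Or.inr (by simp)⟩
  · rintro ⟨i, hi, j, hj, rfl | rfl⟩
    · exact ⟨_, ⟨i, hi, j, hj, Or.inl rfl⟩, by simp⟩
    · exact ⟨_, ⟨i, hi, j, hj, Or.inr rfl⟩, by simp⟩

theorem gridCoord_mem {x y : ℝ} (hx0 : 0 ≤ x) (hx3 : x ≤ 3) (hy0 : 0 ≤ y) (hy3 : y ≤ 3) :
    gridCoord x y ∈ realization (toComplex gridKlein) := by
  obtain ⟨i, hi, s, hs0, hs1, rfl⟩ := exists_cell hx0 hx3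
  obtain ⟨j, hj, t, ht0, ht1, rfl⟩ := exists_cell hy0 hy3
  obtain ⟨h1, h2, h3, h4, h5⟩ := gridLabel_distinct hi hj
  rcases le_total t s with h | h
  · rw [gridCoord_lower hi hj hs1 ht0 h]
    exact combination_mem_realization h1 h2 h3
      (mem_toComplex_gridKlein.2 ⟨i, hi, j, hj, Or.inl rfl⟩) (by linarith) (by linarith) ht0
      (by ring)
  · rw [gridCoord_upper hi hj hs0 ht1 h]
    exact combination_mem_realization h4 h2 h5
      (mem_toComplex_gridKlein.2 ⟨i, hi, j, hj, Or.inr rfl⟩) (by linarith) (by linarith) hs0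
      (by ring)

theorem exists_gridCoord_eq {z : ℕ → ℝ} (hz : z ∈ realization (toComplex gridKlein)) :
    ∃ x y : ℝ, (0 ≤ x ∧ x ≤ 3) ∧ (0 ≤ y ∧ y ≤ 3) ∧ gridCoord x y = z := by
  obtain ⟨h0, t, ht, hsupp, hsum⟩ := hz
  obtain ⟨i, hi, j, hj, ht⟩ := mem_toComplex_gridKlein.1 ht
  obtain ⟨h1, h2, h3, h4, h5⟩ := gridLabel_distinct hi hj
  have hi' : (i : ℝ) ≤ 2 := by exact_mod_cast Nat.le_of_lt_succ hi
  have hj' : (j : ℝ) ≤ 2 := by exact_mod_cast Nat.le_of_lt_succ hj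
  have hi0 : (0 : ℝ) ≤ i := i.cast_nonneg
  have hj0 : (0 : ℝ) ≤ j := j.cast_nonneg
  rcases ht with rfl | rfl
  · rw [Finset.sum_insert (by simp [h1, h2]), Finset.sum_pair h3] at hsum
    rw [eq_combination h1 h2 h3 hsupp]
    have e1 := h0 (gridLabel i j)
    have e2 := h0 (gridLabel (i + 1) j)
    have e3 := h0 (gridLabel (i + 1) (j + 1))
    refine ⟨i + (z (gridLabel (i + 1) j) + z (gridLabel (i + 1) (j + 1))),
      j + z (gridLabel (i + 1) (j + 1)), ⟨by linarith, by linarith⟩, ⟨by linarith, by linarith⟩, ?_⟩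
    rw [gridCoord_lower hi hj (by linarith) e3 (by linarith), add_sub_cancel_right, ← hsum,
      add_sub_cancel_right]
  · rw [Finset.sum_insert (by simp [h4, h2]), Finset.sum_pair h5] at hsum
    rw [eq_combination h4 h2 h5 hsupp]
    have e1 := h0 (gridLabel i j)
    have e2 := h0 (gridLabel i (j + 1))
    have e3 := h0 (gridLabel (i + 1) (j + 1))
    refine ⟨i + z (gridLabel (i + 1) (j + 1)),
      j + (z (gridLabel i (j + 1)) + z (gridLabel (i + 1) (j + 1))),
      ⟨by linarith, by linarith⟩, ⟨by linarith, by linarith⟩, ?_⟩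
    rw [gridCoord_upper hi hj e3 (by linarith) (by linarith), add_sub_cancel_right, ← hsum,
      add_sub_cancel_right]

/-- A point of the circle `ℝ / 3ℤ` is determined by its barycentric coordinates on the triangle
with vertices `0`, `1`, `2`. -/
theorem eq_or_of_circleCoord_eq {i i' : ℕ} (hi : i < 3) (hi' : i' < 3) {s s' : ℝ}
    (h : ∀ c < 3, (if i = c then 1 - s else 0) + (if (i + 1) % 3 = c then s else 0) =
      (if i' = c then 1 - s' else 0) + (if (i' + 1) % 3 = c then s' else 0)) :
    (i + s : ℝ) = i' + s' ∨ ((i + s : ℝ) = 0 ∧ (i' + s' : ℝ) = 3) ∨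
      ((i + s : ℝ) = 3 ∧ (i' + s' : ℝ) = 0) := by
  have h0 := h 0 (by norm_num)
  have h1 := h 1 (by norm_num)
  have h2 := h 2 (by norm_num)
  interval_cases i <;> interval_cases i' <;> norm_num at h0 h1 h2 ⊢ <;> grind

theorem gridLabel_div_three : ∀ k < 4, ∀ l < 4, gridLabel k l < 9 ∧ gridLabel k l / 3 = l % 3 := by
  decide

theorem gridLabel_eq_iff : ∀ j < 3, ∀ c < 3, ∀ k < 4,
    (gridLabel c j = gridLabel k j ↔ k % 3 = c) ∧
    (gridLabel c (j + 1) = gridLabel k (j + 1) ↔ k % 3 = c) ∧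
    gridLabel c j ≠ gridLabel k (j + 1) ∧ gridLabel c (j + 1) ≠ gridLabel k j := by
  decide

/-- The sums of the coordinates over the rows of the grid are the coordinates of `y` on the
circle. -/
theorem sum_row_gridCoord {i j : ℕ} (hi : i < 3) (hj : j < 3) {s t : ℝ} (hs0 : 0 ≤ s) (hs1 : s ≤ 1)
    (ht0 : 0 ≤ t) (ht1 : t ≤ 1) (r : ℕ) :
    ∑ v ∈ Finset.range 9 with v / 3 = r, gridCoord (i + s) (j + t) v =
      (if j = r then 1 - t else 0) + (if (j + 1) % 3 = r then t else 0) := by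
  have key : ∀ k < 4, ∀ l < 4, ∑ v ∈ Finset.range 9 with v / 3 = r,
      (Pi.single (gridLabel k l) 1 : ℕ → ℝ) v = if l % 3 = r then 1 else 0 := by
    intro k hk l hl
    obtain ⟨h1, h2⟩ := gridLabel_div_three k hk l hl
    simp_rw [Pi.single_apply]
    rw [Finset.sum_ite_eq']
    simp [h1, h2]
  rw [gridCoord_cell hi hj hs0 hs1 ht0 ht1]
  simp only [Pi.add_apply, Pi.smul_apply, smul_eq_mul, Finset.sum_add_distrib, ← Finset.mul_sum]
  rw [key i (by omega) j (by omega), key i (by omega) (j + 1) (by omega),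
    key (i + 1) (by omega) j (by omega), key (i + 1) (by omega) (j + 1) (by omega),
    Nat.mod_eq_of_lt hj]
  grind

/-- Within a row of cells, the sums of the coordinates over the columns of the grid are the
coordinates of `x` on the circle. -/
theorem sum_column_gridCoord {i j : ℕ} (hi : i < 3) (hj : j < 3) {s t : ℝ} (hs0 : 0 ≤ s)
    (hs1 : s ≤ 1) (ht0 : 0 ≤ t) (ht1 : t ≤ 1) {c : ℕ} (hc : c < 3) :
    gridCoord (i + s) (j + t) (gridLabel c j) + gridCoord (i + s) (j + t) (gridLabel c (j + 1)) =
      (if i = c then 1 - s else 0) + (if (i + 1) % 3 = c then s else 0) := by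
  obtain ⟨h1, h2, h3, h4⟩ := gridLabel_eq_iff j hj c hc i (by omega)
  obtain ⟨h1', h2', h3', h4'⟩ := gridLabel_eq_iff j hj c hc (i + 1) (by omega)
  rw [gridCoord_cell hi hj hs0 hs1 ht0 ht1]
  simp only [Pi.add_apply, Pi.smul_apply, smul_eq_mul, Pi.single_apply, h1, h2, h3, h4, h1', h2',
    h3', h4', Nat.mod_eq_of_lt hi]
  grind

theorem eq_or_of_gridCoord_eq_left {x x' y : ℝ} (hx0 : 0 ≤ x) (hx3 : x ≤ 3) (hx0' : 0 ≤ x')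
    (hx3' : x' ≤ 3) (hy0 : 0 ≤ y) (hy3 : y ≤ 3) (h : gridCoord x y = gridCoord x' y) :
    x = x' ∨ (x = 0 ∧ x' = 3) ∨ (x = 3 ∧ x' = 0) := by
  obtain ⟨i, hi, s, hs0, hs1, rfl⟩ := exists_cell hx0 hx3
  obtain ⟨i', hi', s', hs0', hs1', rfl⟩ := exists_cell hx0' hx3'
  obtain ⟨j, hj, t, ht0, ht1, rfl⟩ := exists_cell hy0 hy3
  refine eq_or_of_circleCoord_eq hi hi' fun c hc => ?_
  rw [← sum_column_gridCoord hi hj hs0 hs1 ht0 ht1 hc, h,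
    sum_column_gridCoord hi' hj hs0' hs1' ht0 ht1 hc]

theorem eq_or_of_gridCoord_eq_right {x x' y y' : ℝ} (hx0 : 0 ≤ x) (hx3 : x ≤ 3) (hx0' : 0 ≤ x')
    (hx3' : x' ≤ 3) (hy0 : 0 ≤ y) (hy3 : y ≤ 3) (hy0' : 0 ≤ y') (hy3' : y' ≤ 3)
    (h : gridCoord x y = gridCoord x' y') :
    y = y' ∨ (y = 0 ∧ y' = 3) ∨ (y = 3 ∧ y' = 0) := by
  obtain ⟨i, hi, s, hs0, hs1, rfl⟩ := exists_cell hx0 hx3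
  obtain ⟨i', hi', s', hs0', hs1', rfl⟩ := exists_cell hx0' hx3'
  obtain ⟨j, hj, t, ht0, ht1, rfl⟩ := exists_cell hy0 hy3
  obtain ⟨j', hj', t', ht0', ht1', rfl⟩ := exists_cell hy0' hy3'
  refine eq_or_of_circleCoord_eq hj hj' fun c _ => ?_
  rw [← sum_row_gridCoord hi hj hs0 hs1 ht0 ht1, h, sum_row_gridCoord hi' hj' hs0' hs1' ht0' ht1']

theorem gridCoord_parallel {y : ℝ} (hy0 : 0 ≤ y) (hy3 : y ≤ 3) : gridCoord 0 y = gridCoord 3 y := by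
  obtain ⟨j, hj, t, ht0, ht1, rfl⟩ := exists_cell hy0 hy3
  have h1 := gridCoord_upper (i := 0) (by norm_num) hj le_rfl ht1 ht0
  have h2 := gridCoord_lower (i := 2) (by norm_num) hj le_rfl ht0 ht1
  have e : gridLabel 0 j = gridLabel 3 j ∧ gridLabel 0 (j + 1) = gridLabel 3 (j + 1) := by
    interval_cases j <;> decide
  norm_num at h1 h2
  rw [h1, h2, e.1, e.2]

theorem gridCoord_reversed {x : ℝ} (hx0 : 0 ≤ x) (hx3 : x ≤ 3) :
    gridCoord x 0 = gridCoord (3 - x) 3 := by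
  obtain ⟨i, hi, s, hs0, hs1, rfl⟩ := exists_cell hx0 hx3
  have h1 := gridCoord_lower hi (j := 0) (by norm_num) hs1 le_rfl hs0
  have h2 := gridCoord_upper (i := 2 - i) (j := 2) (by omega) (by norm_num) (s := 1 - s)
    (by linarith) le_rfl (by linarith)
  have e : gridLabel i 0 = gridLabel (2 - i + 1) 3 ∧ gridLabel (i + 1) 0 = gridLabel (2 - i) 3 := by
    interval_cases i <;> decide
  have e2 : (3 - (i + s) : ℝ) = (2 - i : ℕ) + (1 - s) := by
    rw [Nat.cast_sub (by omega)]; push_cast; ring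
  norm_num at h1 h2
  rw [e2, h1, h2, e.1, e.2, add_comm]

/-- The realization of the triangulated grid is the Klein bottle: the map `gridCoord` from the
square factors through a continuous bijection from the compact Klein bottle to a Hausdorff space. -/
theorem nonempty_gridKlein_homeomorph_kleinBottle :
    Nonempty (realization (toComplex gridKlein) ≃ₜ KleinBottle) := by
  have b : ∀ x : unitInterval, 0 ≤ 3 * (x : ℝ) ∧ 3 * (x : ℝ) ≤ 3 := fun x =>
    ⟨by linarith [x.2.1], by linarith [x.2.2]⟩
  have hone : ∀ x : unitInterval, 3 * (x : ℝ) = 3 → x = 1 := fun x h =>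
    Subtype.ext (by rw [Set.Icc.coe_one]; linarith)
  let f : unitInterval × unitInterval → realization (toComplex gridKlein) := fun p =>
    ⟨gridCoord (3 * p.1) (3 * p.2), gridCoord_mem (b _).1 (b _).2 (b _).1 (b _).2⟩
  have hf : Continuous f := by
    refine Continuous.subtype_mk (continuous_gridCoord.comp
      (f := fun p : unitInterval × unitInterval => ((3 * p.1 : ℝ), (3 * p.2 : ℝ))) ?_) _
    fun_prop
  have hglue : ∀ p q, KleinGlue p q → f p = f q := by
    rintro _ _ (y | x) <;> refine Subtype.ext ?_
    · simpa [f] using gridCoord_parallel (b y).1 (b y).2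
    · have := gridCoord_reversed (b x).1 (b x).2
      simp only [f, unitInterval.coe_symm_eq, mul_sub, mul_one, Set.Icc.coe_zero, mul_zero,
        Set.Icc.coe_one, this]
  -- on a common horizontal line only the two end points are identified
  have hrow : ∀ x x' y, f (x, y) = f (x', y) →
      (Quot.mk KleinGlue (x, y) : KleinBottle) = Quot.mk KleinGlue (x', y) := by
    intro x x' y h
    rcases eq_or_of_gridCoord_eq_left (b x).1 (b x).2 (b x').1 (b x').2 (b y).1 (b y).2
      (congrArg Subtype.val h) with h | ⟨h, h'⟩ | ⟨h, h'⟩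
    · rw [show x = x' from Subtype.ext (by linarith)]
    · rw [show x = 0 from Subtype.ext (by simpa using h),
        hone x' h']
      exact Quot.sound (.parallel y)
    · rw [show x' = 0 from Subtype.ext (by simpa using h'),
        hone x h]
      exact (Quot.sound (.parallel y)).symm
  have hseam : ∀ x x', f (x, 0) = f (x', 1) →
      (Quot.mk KleinGlue (x, 0) : KleinBottle) = Quot.mk KleinGlue (x', 1) := by
    intro x x' h
    have hg := KleinGlue.reversed (unitInterval.symm x')
    rw [unitInterval.symm_symm] at hg
    rw [← Quot.sound hg]
    exact hrow _ _ _ (h.trans (hglue _ _ hg).symm)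
  have hinj : Function.Injective (Quot.lift f hglue) := by
    rintro ⟨x, y⟩ ⟨x', y'⟩ h
    change f (x, y) = f (x', y') at h
    rcases eq_or_of_gridCoord_eq_right (b x).1 (b x).2 (b x').1 (b x').2 (b y).1 (b y).2
      (b y').1 (b y').2 (congrArg Subtype.val h) with hy | ⟨hy, hy'⟩ | ⟨hy, hy'⟩
    · obtain rfl : y = y' := Subtype.ext (by linarith)
      exact hrow _ _ _ h
    · obtain rfl : y = 0 := Subtype.ext (by simpa using hy)
      obtain rfl := hone y' hy'
      exact hseam _ _ h
    · obtain rfl : y' = 0 := Subtype.ext (by simpa using hy')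
      obtain rfl := hone y hy
      exact (hseam _ _ h.symm).symm
  have hsurj : Function.Surjective (Quot.lift f hglue) := by
    rintro ⟨z, hz⟩
    obtain ⟨x, y, hx, hy, rfl⟩ := exists_gridCoord_eq hz
    refine ⟨Quot.mk _ (⟨x / 3, by constructor <;> linarith [hx.1, hx.2]⟩,
      ⟨y / 3, by constructor <;> linarith [hy.1, hy.2]⟩), Subtype.ext ?_⟩
    change gridCoord (3 * (x / 3)) (3 * (y / 3)) = _
    rw [mul_div_cancel₀ x three_ne_zero, mul_div_cancel₀ y three_ne_zero]
  exact ⟨(Continuous.homeoOfEquivCompactToT2 (f := Equiv.ofBijective _ ⟨hinj, hsurj⟩)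
    (continuous_quot_lift hglue hf)).symm⟩

/-! ### The carrier of a polyhedral map as a simplicial complex -/

section Transport

variable {W W' : Type*}

theorem extend_mem_realization_image (h : W ↪ W') {K : Set (Finset W)} {x : W → ℝ}
    (hx : x ∈ realization K) :
    Function.extend h x 0 ∈ realization ((fun t => t.map h) '' K) := by
  obtain ⟨h0, t, ht, hsupp, hsum⟩ := hx
  refine ⟨fun w => ?_, t.map h, ⟨t, ht, rfl⟩, fun w hw => ?_, ?_⟩
  · by_cases hw : ∃ v, h v = w
    · obtain ⟨v, rfl⟩ := hw
      rw [h.injective.extend_apply]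
      exact h0 v
    · rw [Function.extend_apply' _ _ _ hw, Pi.zero_apply]
  · by_cases hw' : ∃ v, h v = w
    · obtain ⟨v, rfl⟩ := hw'
      rw [h.injective.extend_apply]
      exact hsupp v (by simpa using hw)
    · rw [Function.extend_apply' _ _ _ hw', Pi.zero_apply]
  · rw [Finset.sum_map, ← hsum]
    exact Finset.sum_congr rfl fun v _ => h.injective.extend_apply _ _ _

theorem comp_mem_realization (h : W ↪ W') {K : Set (Finset W)} {y : W' → ℝ}
    (hy : y ∈ realization ((fun t => t.map h) '' K)) : y ∘ h ∈ realization K := by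
  obtain ⟨h0, _, ⟨t, ht, rfl⟩, hsupp, hsum⟩ := hy
  refine ⟨fun w => h0 _, t, ht, fun w hw => hsupp _ (by simpa using hw), ?_⟩
  rw [← hsum, Finset.sum_map]
  rfl

theorem extend_comp_of_mem_realization_image (h : W ↪ W') {K : Set (Finset W)} {y : W' → ℝ}
    (hy : y ∈ realization ((fun t => t.map h) '' K)) : Function.extend h (y ∘ h) 0 = y := by
  obtain ⟨h0, _, ⟨t, ht, rfl⟩, hsupp, hsum⟩ := hy
  funext w
  by_cases hw : ∃ v, h v = w
  · obtain ⟨v, rfl⟩ := hw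
    exact h.injective.extend_apply _ _ _
  · rw [Function.extend_apply' _ _ _ hw, Pi.zero_apply]
    refine (hsupp w fun hw' => hw ?_).symm
    obtain ⟨v, -, hv⟩ := Finset.mem_map.1 hw'
    exact ⟨v, hv⟩

theorem continuous_extend_zero (h : W ↪ W') :
    Continuous fun x : W → ℝ => Function.extend h x 0 := by
  refine continuous_pi fun w => ?_
  by_cases hw : ∃ v, h v = w
  · obtain ⟨v, rfl⟩ := hw
    simp only [h.injective.extend_apply]
    fun_prop
  · simp only [Function.extend_apply' _ _ _ hw]
    exact continuous_const

/-- Renaming the vertices does not change the realization. -/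
theorem homeoRealizations_image (h : W ↪ W') (K : Set (Finset W)) :
    HomeoRealizations K ((fun t => t.map h) '' K) :=
  ⟨{toFun := fun x => ⟨Function.extend h x.1 0, extend_mem_realization_image h x.2⟩
    invFun := fun y => ⟨y.1 ∘ h, comp_mem_realization h y.2⟩
    left_inv := fun _ => Subtype.ext (funext fun _ => h.injective.extend_apply _ _ _)
    right_inv := fun y => Subtype.ext (extend_comp_of_mem_realization_image h y.2)
    continuous_toFun := ((continuous_extend_zero h).comp continuous_subtype_val).subtype_mk _
    continuous_invFun := ((by fun_prop : Continuous fun y : W' → ℝ => y ∘ h).comp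
      continuous_subtype_val).subtype_mk _}⟩

theorem mem_convexHull_single_iff [DecidableEq W] (t : Finset W) (x : W → ℝ) :
    x ∈ convexHull ℝ ((fun w => (Pi.single w 1 : W → ℝ)) '' t) ↔
      (∀ w, 0 ≤ x w) ∧ (∀ w, w ∉ t → x w = 0) ∧ ∑ w ∈ t, x w = 1 := by
  constructor
  · intro hx
    have hconv : Convex ℝ {x : W → ℝ | (∀ w, 0 ≤ x w) ∧ (∀ w, w ∉ t → x w = 0) ∧
        ∑ w ∈ t, x w = 1} := by
      rintro x ⟨h0, h1, h2⟩ y ⟨h0', h1', h2'⟩ a b ha hb hab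
      refine ⟨fun w => ?_, fun w hw => ?_, ?_⟩
      · have := h0 w
        have := h0' w
        simp only [Pi.add_apply, Pi.smul_apply, smul_eq_mul]
        positivity
      · simp [h1 w hw, h1' w hw]
      · simp [Finset.sum_add_distrib, ← Finset.mul_sum, h2, h2', hab]
    refine convexHull_min ?_ hconv hx
    rintro _ ⟨w, hw, rfl⟩
    refine ⟨fun v => ?_, fun v hv => ?_, ?_⟩
    · by_cases h : v = w <;> simp [h]
    · have : v ≠ w := fun h => hv (h ▸ hw)
      simp [this]
    · simpa using hw
  · rintro ⟨h0, h1, h2⟩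
    have hx : x = ∑ w ∈ t, x w • (Pi.single w 1 : W → ℝ) := by
      funext v
      by_cases hv : v ∈ t
      · simp [Finset.sum_apply, Pi.single_apply, hv]
      · simp [Finset.sum_apply, Pi.single_apply, hv, h1 v hv]
    rw [hx]
    exact (convex_convexHull ℝ _).sum_mem (fun w _ => h0 w) h2 fun w hw =>
      subset_convexHull _ _ ⟨w, hw, rfl⟩

end Transport

namespace PolyhedralMap

variable {V : Type*} (X : PolyhedralMap V)

/-- The triangles spanned by the centre of a face and one of its edges. -/
def coneTriangles : Set (Finset (V ⊕ X.faces)) :=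
  {t | ∃ (C : X.faces) (u v : V), s(u, v) ∈ C.1 ∧
    ∀ w, w ∈ t ↔ w = Sum.inl u ∨ w = Sum.inl v ∨ w = Sum.inr C}

theorem carrier_eq_realization : X.carrier = realization X.coneTriangles := by
  classical
  have key : ∀ (C : X.faces) (u v : V),
      ({Pi.single (Sum.inl u) (1 : ℝ), Pi.single (Sum.inl v) (1 : ℝ),
          Pi.single (Sum.inr C) (1 : ℝ)} :
        Set (V ⊕ X.faces → ℝ)) = (fun w => Pi.single w 1) ''
          (({Sum.inl u, Sum.inl v, Sum.inr C} : Finset (V ⊕ X.faces)) : Set (V ⊕ X.faces)) := by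
    intro C u v
    simp [Set.image_insert_eq]
  ext x
  constructor
  · rintro ⟨C, u, v, huv, hx⟩
    have hx' := (mem_convexHull_single_iff {Sum.inl u, Sum.inl v, Sum.inr C} x).1
      (by rw [← key]; convert hx)
    exact ⟨hx'.1, _, ⟨C, u, v, huv, by simp⟩, hx'.2⟩
  · rintro ⟨h0, t, ⟨C, u, v, huv, ht⟩, h⟩
    have ht' : t = {Sum.inl u, Sum.inl v, Sum.inr C} := by ext w; simp [ht]
    refine ⟨C, u, v, huv, ?_⟩
    have := (mem_convexHull_single_iff {Sum.inl u, Sum.inl v, Sum.inr C} x).2 (ht' ▸ ⟨h0, h⟩)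
    rw [← key] at this
    convert this

end PolyhedralMap

/-! ### Polyhedral maps from lists of polygons -/

section Cycle

variable {V : Type*}

/-- The edges of the closed polygon with the vertices `l`, directed along `l`. -/
def cycleEdges (l : List V) : List (V × V) :=
  l.zip (l.rotate 1)

theorem val_finRotate {n : ℕ} (i : Fin n) : (finRotate n i : ℕ) = (i + 1) % n := by
  cases n with
  | zero => exact i.elim0
  | succ n => rw [finRotate_apply, Fin.val_add]; simp

theorem mem_cycleEdges {l : List V} {p : V × V} :
    p ∈ cycleEdges l ↔ ∃ i : Fin l.length, p = (l.get i, l.get (finRotate _ i)) := by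
  unfold cycleEdges
  rw [List.mem_iff_getElem]
  constructor
  · rintro ⟨i, hi, rfl⟩
    have hi' : i < l.length := by simp at hi; exact hi
    refine ⟨⟨i, hi'⟩, ?_⟩
    simp [List.getElem_rotate, val_finRotate, -finRotate_apply]
  · rintro ⟨i, rfl⟩
    refine ⟨i, by simp, ?_⟩
    simp [List.getElem_rotate, val_finRotate, -finRotate_apply]

theorem mem_of_mem_cycleEdges {l : List V} {p : V × V} (h : p ∈ cycleEdges l) :
    p.1 ∈ l ∧ p.2 ∈ l := by
  obtain ⟨i, rfl⟩ := mem_cycleEdges.1 h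
  exact ⟨List.get_mem _ _, List.get_mem _ _⟩

variable [DecidableEq V]

/-- `u` and `v` are neighbours on the closed polygon with the vertices `l`. -/
def Consecutive (l : List V) (u v : V) : Prop :=
  (u, v) ∈ cycleEdges l ∨ (v, u) ∈ cycleEdges l

instance (l : List V) (u v : V) : Decidable (Consecutive l u v) :=
  inferInstanceAs (Decidable (_ ∨ _))

/-- The closed polygon with the vertices `l`, as a set of edges. -/
def polygonOf (l : List V) : Finset (Sym2 V) :=
  ((cycleEdges l).map fun p => s(p.1, p.2)).toFinset

theorem mk_mem_polygonOf {l : List V} {u v : V} : s(u, v) ∈ polygonOf l ↔ Consecutive l u v := by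
  simp only [polygonOf, List.mem_toFinset, List.mem_map, Prod.exists, Sym2.eq_iff, Consecutive]
  grind

theorem isPolygon_polygonOf {l : List V} (h : 3 ≤ l.length) (hl : l.Nodup) :
    IsPolygon l.length (polygonOf l) := by
  refine ⟨h, l.get, List.nodup_iff_injective_get.1 hl, fun e => ?_⟩
  simp only [polygonOf, List.mem_toFinset, List.mem_map, mem_cycleEdges]
  grind

theorem polygonVertices_polygonOf (l : List V) : polygonVertices (polygonOf l) = {v | v ∈ l} := by
  ext v
  constructor
  · rintro ⟨e, he, hv⟩
    induction e using Sym2.ind with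
    | h x y =>
      rcases mk_mem_polygonOf.1 he with h | h <;> have := mem_of_mem_cycleEdges h <;>
        rcases Sym2.mem_iff.1 hv with rfl | rfl <;> simp_all
  · intro hv
    obtain ⟨i, rfl⟩ := List.get_of_mem hv
    exact ⟨s(l.get i, l.get (finRotate _ i)),
      mk_mem_polygonOf.2 (Or.inl (mem_cycleEdges.2 ⟨i, rfl⟩)),
      by simp⟩

/-- Two closed polygons are disjoint or meet in one vertex or in one edge. -/
def MeetProperly (l l' : List V) : Prop :=
  (∀ x ∈ l, x ∉ l') ∨ (∃ u ∈ l, ∀ x ∈ l, x ∈ l' ↔ x = u) ∨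
    ∃ u ∈ l, ∃ v ∈ l, Consecutive l u v ∧ Consecutive l' u v ∧ ∀ x ∈ l, x ∈ l' ↔ x = u ∨ x = v

instance (l l' : List V) : Decidable (MeetProperly l l') :=
  inferInstanceAs (Decidable (_ ∨ _ ∨ _))

theorem MeetProperly.not_subset {l l' : List V} (h : MeetProperly l l') (h3 : 3 ≤ l.length)
    (hl : l.Nodup) : ¬ l ⊆ l' := by
  intro hsub
  have hcard : l.toFinset.card = l.length := List.toFinset_card_of_nodup hl
  rcases h with h | ⟨u, -, h⟩ | ⟨u, -, v, -, -, -, h⟩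
  · obtain ⟨x, hx⟩ : ∃ x, x ∈ l := List.exists_mem_of_length_pos (by omega)
    exact h x hx (hsub hx)
  · have : l.toFinset ⊆ {u} := fun x hx => by
      have hx := List.mem_toFinset.1 hx
      simpa using (h x hx).1 (hsub hx)
    have := Finset.card_le_card this
    simp at this
    omega
  · have : l.toFinset ⊆ {u, v} := fun x hx => by
      have hx := List.mem_toFinset.1 hx
      simpa using (h x hx).1 (hsub hx)
    have := (Finset.card_le_card this).trans Finset.card_le_two
    omega

theorem MeetProperly.inter {l l' : List V} (h : MeetProperly l l') :
    polygonVertices (polygonOf l) ∩ polygonVertices (polygonOf l') = ∅ ∨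
    (∃ v, polygonVertices (polygonOf l) ∩ polygonVertices (polygonOf l') = {v}) ∨
    (∃ u v, s(u, v) ∈ polygonOf l ∧ s(u, v) ∈ polygonOf l' ∧
      polygonVertices (polygonOf l) ∩ polygonVertices (polygonOf l') = {u, v}) := by
  rw [polygonVertices_polygonOf, polygonVertices_polygonOf]
  rcases h with h | ⟨u, hu, h⟩ | ⟨u, hu, v, hv, h1, h2, h⟩
  · exact Or.inl (by ext x; simpa using h x)
  · refine Or.inr (Or.inl ⟨u, ?_⟩)
    ext x
    simp only [mem_inter_iff, mem_ofPred_eq, mem_singleton_iff]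
    grind
  · refine Or.inr (Or.inr ⟨u, v, mk_mem_polygonOf.2 h1, mk_mem_polygonOf.2 h2, ?_⟩)
    ext x
    simp only [mem_inter_iff, mem_ofPred_eq, mem_insert_iff, mem_singleton_iff]
    grind

/-- The polygons `L` have distinct vertices, at least three each, and meet properly. -/
def IsPolygonList (L : List (List V)) : Prop :=
  (∀ l ∈ L, 3 ≤ l.length ∧ l.Nodup) ∧ L.Pairwise MeetProperly

instance (L : List (List V)) : Decidable (IsPolygonList L) :=
  inferInstanceAs (Decidable (_ ∧ _))

theorem IsPolygonList.nodup_map {L : List (List V)} (h : IsPolygonList L) :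
    (L.map polygonOf).Nodup := by
  rw [List.Nodup, List.pairwise_map]
  refine h.2.imp_of_mem fun {l l'} hl _ hm heq => ?_
  refine hm.not_subset (h.1 l hl).1 (h.1 l hl).2 fun x hx => ?_
  have := congrArg polygonVertices heq
  rw [polygonVertices_polygonOf, polygonVertices_polygonOf] at this
  exact this.subset hx

theorem IsPolygonList.injOn {L : List (List V)} (h : IsPolygonList L) {l l' : List V} (hl : l ∈ L)
    (hl' : l' ∈ L) (he : polygonOf l = polygonOf l') : l = l' :=
  List.inj_on_of_nodup_map h.nodup_map hl hl' he

/-- The list `A` of pairs `(l, w)` is the face-cycle of `v` in `L`: the polygon `l` contains the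
neighbour `w` of `v` and the neighbour that belongs to the next polygon.  The polygons have the
numbers `τ` of vertices. -/
def IsFaceCycleList (L : List (List V)) (τ : List ℕ) (v : V) (A : List (List V × V)) : Prop :=
  3 ≤ A.length ∧ A.map (fun p => p.1.length) = τ ∧ (A.map Prod.fst).Nodup ∧ (A.map Prod.snd).Nodup ∧
    (∀ p ∈ A, p.1 ∈ L) ∧ (∀ l ∈ L, v ∈ l → l ∈ A.map Prod.fst) ∧
    ∀ p ∈ cycleEdges A, Consecutive p.1.1 v p.1.2 ∧ Consecutive p.1.1 v p.2.2

instance (L : List (List V)) (τ : List ℕ) (v : V) (A : List (List V × V)) :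
    Decidable (IsFaceCycleList L τ v A) :=
  inferInstanceAs (Decidable (_ ∧ _ ∧ _ ∧ _ ∧ _ ∧ _ ∧ _))

theorem IsFaceCycleList.exists_isFaceCycle {L : List (List V)} (hL : IsPolygonList L) {τ : List ℕ}
    {v : V} {A : List (List V × V)} (hA : IsFaceCycleList L τ v A) :
    ∃ B : Fin τ.length → Finset (Sym2 V), IsFaceCycle (L.map polygonOf).toFinset v B ∧
      ∀ i, IsPolygon (τ.get i) (B i) := by
  obtain ⟨h3, rfl, hfst, hsnd, hmem, hall, hcons⟩ := hA
  suffices h : ∀ d (hd : d = A.length), ∃ B : Fin d → Finset (Sym2 V),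
      IsFaceCycle (L.map polygonOf).toFinset v B ∧
        ∀ i : Fin d, IsPolygon (A.get (i.cast hd)).1.length (B i) by
    obtain ⟨B, hB, hB'⟩ := h _ (List.length_map _)
    exact ⟨B, hB, fun i => by simpa using hB' i⟩
  rintro _ rfl
  have hcons' : ∀ i : Fin A.length, Consecutive (A.get i).1 v (A.get i).2 ∧
      Consecutive (A.get i).1 v (A.get (finRotate _ i)).2 := fun i =>
    hcons _ (mem_cycleEdges.2 ⟨i, rfl⟩)
  have inj1 : ∀ i j : Fin A.length, (A.get i).1 = (A.get j).1 → i = j := fun i j hij =>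
    Fin.ext ((hfst.getElem_inj_iff (hi := by simp) (hj := by simp)).1 (by simpa using hij))
  have inj2 : ∀ i j : Fin A.length, (A.get i).2 = (A.get j).2 → i = j := fun i j hij =>
    Fin.ext ((hsnd.getElem_inj_iff (hi := by simp) (hj := by simp)).1 (by simpa using hij))
  refine ⟨fun i => polygonOf (A.get i).1, ⟨h3, fun i j hij => ?_, fun C => ?_,
    fun i => (A.get i).2, inj2, fun i => ?_⟩, fun i => ?_⟩
  · exact inj1 i j (hL.injOn (hmem _ (List.get_mem _ _)) (hmem _ (List.get_mem _ _)) hij)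
  · constructor
    · rintro ⟨hC, hv⟩
      obtain ⟨l, hl, rfl⟩ := List.mem_map.1 (List.mem_toFinset.1 hC)
      rw [polygonVertices_polygonOf] at hv
      obtain ⟨p, hp, rfl⟩ := List.mem_map.1 (hall l hl hv)
      obtain ⟨i, rfl⟩ := List.get_of_mem hp
      exact ⟨i, rfl⟩
    · rintro ⟨i, rfl⟩
      refine ⟨List.mem_toFinset.2 (List.mem_map_of_mem (hmem _ (List.get_mem _ _))), ?_⟩
      exact ⟨_, mk_mem_polygonOf.2 (hcons' i).1, by simp⟩
  · exact ⟨mk_mem_polygonOf.2 (hcons' i).1, mk_mem_polygonOf.2 (hcons' i).2⟩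
  · have := hL.1 _ (hmem _ (List.get_mem A i))
    exact isPolygon_polygonOf this.1 this.2

/-- The corners at `v` of the polygons `L`: the polygon and the two neighbours of `v` on it. -/
def corners (L : List (List V)) (v : V) : List (List V × V × V) :=
  L.flatMap fun l => ((cycleEdges l).zip (cycleEdges (l.rotate 1))).filterMap fun p =>
    if p.1.2 = v then some (l, p.1.1, p.2.2) else none

/-- The corners `cs` in cyclic order: starting with the neighbour `w`, the first unused corner with
this neighbour is chosen in each step.  The first argument bounds the length. -/
def turn : ℕ → List (List V × V × V) → V → List (List V × V)
  | 0, _, _ => []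
  | k + 1, cs, w =>
    match cs.find? (fun c => c.2.1 = w ∨ c.2.2 = w) with
    | none => []
    | some c => (c.1, w) :: turn k (cs.erase c) (if c.2.1 = w then c.2.2 else c.2.1)

/-- The cyclic orders of the corners at `v`, with all starting points and both directions. -/
def turns (L : List (List V)) (v : V) : List (List (List V × V)) :=
  let cs := corners L v
  cs.flatMap fun c => [turn cs.length cs c.2.1, turn cs.length cs.reverse c.2.1,
    turn cs.length cs c.2.2, turn cs.length cs.reverse c.2.2]

/-- The polygons `L` around each vertex form a cycle of polygons with the numbers `τ` of
vertices. -/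
def IsSemiEquivelarList (L : List (List V)) (τ : List ℕ) : Prop :=
  ∀ v, ∃ A ∈ turns L v, IsFaceCycleList L τ v A

instance [Fintype V] (L : List (List V)) (τ : List ℕ) : Decidable (IsSemiEquivelarList L τ) :=
  inferInstanceAs (Decidable (∀ _, _))

namespace PolyhedralMap

/-- The polyhedral map with the faces `L`. -/
def ofList (L : List (List V)) (τ : List ℕ) (hL : IsPolygonList L) (hτ : IsSemiEquivelarList L τ) :
    PolyhedralMap V where
  faces := (L.map polygonOf).toFinset
  polygon C hC := by
    obtain ⟨l, hl, rfl⟩ := List.mem_map.1 (List.mem_toFinset.1 hC)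
    exact ⟨_, isPolygon_polygonOf (hL.1 l hl).1 (hL.1 l hl).2⟩
  inter C hC D hD hCD := by
    let R : Finset (Sym2 V) → Finset (Sym2 V) → Prop := fun C D =>
      polygonVertices C ∩ polygonVertices D = ∅ ∨
        (∃ v, polygonVertices C ∩ polygonVertices D = {v}) ∨
        (∃ u v, s(u, v) ∈ C ∧ s(u, v) ∈ D ∧ polygonVertices C ∩ polygonVertices D = {u, v})
    have : Std.Symm R := ⟨fun C D h => by
      simp only [R] at h ⊢
      rw [Set.inter_comm]
      grind⟩
    have hp : (L.map polygonOf).Pairwise R := List.pairwise_map.2 (hL.2.imp MeetProperly.inter)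
    exact hp.forall (List.mem_toFinset.1 hC) (List.mem_toFinset.1 hD) hCD
  link v := by
    obtain ⟨A, -, hA⟩ := hτ v
    obtain ⟨B, hB, -⟩ := hA.exists_isFaceCycle hL
    exact ⟨_, B, hB⟩

theorem isSemiEquivelarOfType_ofList {L : List (List V)} {τ : List (ℕ × ℕ)} (hL : IsPolygonList L)
    (hτ : IsSemiEquivelarList L (expandType τ)) :
    (ofList L _ hL hτ).IsSemiEquivelarOfType τ := by
  intro v
  obtain ⟨A, -, hA⟩ := hτ v
  exact hA.exists_isFaceCycle hL

end PolyhedralMap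

end Cycle

/-! ### The surface of a polyhedral map given by a list -/

section Cone

variable {n : ℕ}

/-- The list of the triangles spanned by the centres and the edges of the polygons `L`, where the
centre of the `i`-th polygon has the label `n + i`. -/
def coneList (L : List (List (Fin n))) : List (List ℕ) :=
  L.zipIdx.flatMap fun p => (cycleEdges p.1).map fun e => [n + p.2, e.1, e.2]

/-- The labels of the vertices and of the centres of the faces. -/
def coneLabel {L : List (List (Fin n))} {τ : List ℕ} (hL : IsPolygonList L)
    (hτ : IsSemiEquivelarList L τ) : Fin n ⊕ (PolyhedralMap.ofList L τ hL hτ).faces ↪ ℕ where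
  toFun := Sum.elim (fun v => v) fun C => n + (L.map polygonOf).idxOf C.1
  inj' := by
    rintro (v | ⟨C, hC⟩) (v' | ⟨C', hC'⟩) h <;> simp only [Sum.elim_inl, Sum.elim_inr] at h
    · rw [Fin.ext h]
    · have := v.2
      omega
    · have := v'.2
      omega
    · have hidx : (L.map polygonOf).idxOf C = (L.map polygonOf).idxOf C' := by omega
      obtain rfl := (List.idxOf_inj (List.mem_toFinset.1 hC)).1 hidx
      rfl

theorem toComplex_coneList {L : List (List (Fin n))} {τ : List ℕ} (hL : IsPolygonList L)
    (hτ : IsSemiEquivelarList L τ) : toComplex (coneList L) =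
      (fun t => t.map (coneLabel hL hτ)) '' (PolyhedralMap.ofList L τ hL hτ).coneTriangles := by
  -- the triangle over an edge of a polygon, in both descriptions
  have key : ∀ {l : List (Fin n)} {i : ℕ} (_ : L[i]? = some l) (u v : Fin n)
      (C : (PolyhedralMap.ofList L τ hL hτ).faces) (_ : C.1 = polygonOf l)
      (t : Finset (Fin n ⊕ (PolyhedralMap.ofList L τ hL hτ).faces)),
      (∀ w, w ∈ t ↔ w = Sum.inl u ∨ w = Sum.inl v ∨ w = Sum.inr C) →
      ([n + i, u, v] : List ℕ).toFinset = t.map (coneLabel hL hτ) := by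
    intro l i hi u v C hC t ht
    have hidx : (L.map polygonOf).idxOf C.1 = i := by
      obtain ⟨hlt, rfl⟩ := List.getElem?_eq_some_iff.1 hi
      have := hL.nodup_map.idxOf_getElem i (by simpa using hlt)
      simpa [hC] using this
    have h1 : ∀ v, coneLabel hL hτ (Sum.inl v) = v := fun _ => rfl
    have h2 : coneLabel hL hτ (Sum.inr C) = n + i := by rw [← hidx]; rfl
    ext w
    simp only [Finset.mem_map, ht, or_and_right, exists_or, exists_eq_left, h1, h2,
      List.mem_toFinset, List.mem_cons, List.not_mem_nil, or_false]
    grind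
  ext t
  simp only [toComplex, coneList, List.mem_flatMap, List.mem_map, mem_ofPred_eq, Prod.exists,
    List.mk_mem_zipIdx_iff_getElem?, mem_image]
  constructor
  · rintro ⟨_, ⟨l, i, hi, u, v, huv, rfl⟩, rfl⟩
    let C : (PolyhedralMap.ofList L τ hL hτ).faces := ⟨polygonOf l,
      List.mem_toFinset.2 (List.mem_map_of_mem (List.mem_of_getElem? hi))⟩
    have ht : ∀ w, w ∈ ({Sum.inl u, Sum.inl v, Sum.inr C} : Finset _) ↔
      w = Sum.inl u ∨ w = Sum.inl v ∨ w = Sum.inr C := by simp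
    exact ⟨_, ⟨C, u, v, mk_mem_polygonOf.2 (Or.inl huv), ht⟩, (key hi u v C rfl _ ht).symm⟩
  · rintro ⟨t, ⟨⟨C, hC⟩, u, v, huv, ht⟩, rfl⟩
    obtain ⟨l, hl, rfl⟩ := List.mem_map.1 (List.mem_toFinset.1 hC)
    obtain ⟨i, hi⟩ := List.mem_iff_getElem?.1 hl
    rcases mk_mem_polygonOf.1 huv with h | h
    · exact ⟨_, ⟨l, i, hi, u, v, h, rfl⟩, key hi u v _ rfl t ht⟩
    · exact ⟨_, ⟨l, i, hi, v, u, h, rfl⟩, key hi v u _ rfl t fun w => by rw [ht w, or_left_comm]⟩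

theorem isMapOn_kleinBottle_ofList {L : List (List (Fin n))} {τ : List ℕ} (hL : IsPolygonList L)
    (hτ : IsSemiEquivelarList L τ) {as : List ℕ}
    (h : (contractAll as (coneList L)).any (SameSimplices · gridKlein)) :
    (PolyhedralMap.ofList L τ hL hτ).IsMapOn KleinBottle := by
  rw [Option.any_eq_true] at h
  obtain ⟨K, hK, hK'⟩ := h
  have h1 := homeoRealizations_image (coneLabel hL hτ)
    (PolyhedralMap.ofList L τ hL hτ).coneTriangles
  rw [← toComplex_coneList] at h1
  have h2 := h1.trans (homeoRealizations_of_contractAll_eq_some hK)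
  rw [(of_decide_eq_true hK').toComplex_eq] at h2
  rw [PolyhedralMap.IsMapOn, PolyhedralMap.carrier_eq_realization]
  exact ⟨h2.some.trans nonempty_gridKlein_homeomorph_kleinBottle.some⟩

end Cone

/-! ### Walks and automorphisms -/

namespace PolyhedralMap

variable {V : Type*} (X : PolyhedralMap V)

/-- The end points of the walks of length `k` that start at `v` and run along edges of `X`. -/
def walkEnds : ℕ → V → Set V
  | 0, v => {v}
  | k + 1, v => {w | ∃ u ∈ walkEnds k v, ∃ C ∈ X.faces, s(u, w) ∈ C}

variable {X}

theorem IsAut.symm {σ : Equiv.Perm V} (h : X.IsAut σ) : X.IsAut σ.symm := by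
  intro C
  rw [h (C.map σ.symm.toEmbedding.sym2Map), Finset.map_map]
  have : σ.symm.toEmbedding.sym2Map.trans σ.toEmbedding.sym2Map = Function.Embedding.refl _ := by
    ext e
    simp [Sym2.map_map]
  rw [this, Finset.map_refl]

theorem IsAut.mem_walkEnds {σ : Equiv.Perm V} (h : X.IsAut σ) {v : V} :
    ∀ {k : ℕ} {w : V}, w ∈ X.walkEnds k v → σ w ∈ X.walkEnds k (σ v)
  | 0, w, hw => by
    rw [walkEnds, mem_singleton_iff] at hw ⊢
    rw [hw]
  | k + 1, w, ⟨u, hu, C, hC, huC⟩ =>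
    ⟨σ u, h.mem_walkEnds hu, _, (h C).1 hC, Finset.mem_map.2 ⟨_, huC, rfl⟩⟩

theorem IsAut.image_walkEnds {σ : Equiv.Perm V} (h : X.IsAut σ) (k : ℕ) (v : V) :
    σ '' X.walkEnds k v = X.walkEnds k (σ v) := by
  ext w
  constructor
  · rintro ⟨u, hu, rfl⟩
    exact h.mem_walkEnds hu
  · intro hw
    refine ⟨σ.symm w, ?_, by simp⟩
    simpa using h.symm.mem_walkEnds hw

theorem not_vertexTransitive_of_ncard_walkEnds_ne {k : ℕ} {u v : V}
    (h : (X.walkEnds k u).ncard ≠ (X.walkEnds k v).ncard) : ¬ X.VertexTransitive := by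
  intro ht
  obtain ⟨σ, hσ, rfl⟩ := ht u v
  rw [← hσ.image_walkEnds, Set.ncard_image_of_injective _ σ.injective] at h
  exact h rfl

end PolyhedralMap

section Walks

variable {V : Type*}

/-- All edges of the polygons `L`, in both directions. -/
def allEdges (L : List (List V)) : List (V × V) :=
  L.flatMap fun l => cycleEdges l ++ (cycleEdges l).map Prod.swap

theorem mem_allEdges {L : List (List V)} {u w : V} :
    (u, w) ∈ allEdges L ↔ ∃ l ∈ L, Consecutive l u w := by
  simp only [allEdges, List.mem_flatMap, List.mem_append, List.mem_map, Prod.exists, Prod.swap,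
    Prod.mk.injEq, Consecutive]
  grind

variable [DecidableEq V]

/-- The list of the end points of the walks of length `k` from `v` along the edges `E`. -/
def walkEndsList (E : List (V × V)) : ℕ → V → List V
  | 0, v => [v]
  | k + 1, v =>
    let S := walkEndsList E k v
    ((E.filter fun e => e.1 ∈ S).map Prod.snd).dedup

theorem mem_walkEnds_ofList {L : List (List V)} {τ : List ℕ} (hL : IsPolygonList L)
    (hτ : IsSemiEquivelarList L τ) (v : V) : ∀ (k : ℕ) (w : V),
    w ∈ (PolyhedralMap.ofList L τ hL hτ).walkEnds k v ↔ w ∈ walkEndsList (allEdges L) k v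
  | 0, w => by simp [PolyhedralMap.walkEnds, walkEndsList]
  | k + 1, w => by
    have hstep : ∀ u, (∃ C ∈ (PolyhedralMap.ofList L τ hL hτ).faces, s(u, w) ∈ C) ↔
        (u, w) ∈ allEdges L := by
      intro u
      rw [mem_allEdges]
      simp only [PolyhedralMap.ofList, List.mem_toFinset, List.mem_map, exists_exists_and_eq_and,
        mk_mem_polygonOf]
    simp only [PolyhedralMap.walkEnds, mem_ofPred_eq, mem_walkEnds_ofList hL hτ v k, hstep,
      walkEndsList, List.mem_dedup, List.mem_map, List.mem_filter, decide_eq_true_eq, Prod.exists,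
      exists_eq_right]
    simp only [and_comm]

theorem ncard_walkEnds_ofList {L : List (List V)} {τ : List ℕ} (hL : IsPolygonList L)
    (hτ : IsSemiEquivelarList L τ) (k : ℕ) (v : V) :
    ((PolyhedralMap.ofList L τ hL hτ).walkEnds k v).ncard =
      (walkEndsList (allEdges L) k v).length := by
  have h : (PolyhedralMap.ofList L τ hL hτ).walkEnds k v =
      (walkEndsList (allEdges L) k v).toFinset := by
    ext w
    simp [mem_walkEnds_ofList]
  rw [h, Set.ncard_coe_finset, List.toFinset_card_of_nodup]
  cases k with
  | zero => simp [walkEndsList]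
  | succ k => exact List.nodup_dedup _

end Walks

/-! ### Maps that are not vertex-transitive -/

/-- There is a semi-equivelar map of type `τ` on the Klein bottle that is not vertex-transitive. -/
def HasNonTransitiveKleinMap (τ : List (ℕ × ℕ)) : Prop :=
  ∃ (V : Type) (_ : Finite V) (X : PolyhedralMap V),
    X.IsMapOn KleinBottle ∧ X.IsSemiEquivelarOfType τ ∧ ¬ X.VertexTransitive

/-- A map on the Klein bottle of type `τ` that is not vertex-transitive, from data that can be
checked by computation: the list `L` of its faces, the list `as` of the vertices to which the
contractions are performed, and two vertices `u`, `v` from which walks of length `k` reach different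
numbers of vertices. -/
theorem hasNonTransitiveKleinMap_of_list {n : ℕ} (L : List (List (Fin n))) (as : List ℕ) (k : ℕ)
    (u v : Fin n) {τ : List (ℕ × ℕ)} (hL : IsPolygonList L)
    (hτ : IsSemiEquivelarList L (PolyhedralMap.expandType τ))
    (has : (contractAll as (coneList L)).any (SameSimplices · gridKlein))
    (hk : (walkEndsList (allEdges L) k u).length ≠ (walkEndsList (allEdges L) k v).length) :
    HasNonTransitiveKleinMap τ :=
  ⟨Fin n, inferInstance, PolyhedralMap.ofList L _ hL hτ, isMapOn_kleinBottle_ofList hL hτ has,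
    PolyhedralMap.isSemiEquivelarOfType_ofList hL hτ,
    PolyhedralMap.not_vertexTransitive_of_ncard_walkEnds_ne (k := k) (u := u) (v := v) (by
      rwa [ncard_walkEnds_ofList, ncard_walkEnds_ofList])⟩

/-! ### The ten maps

The vertices are labelled such that the vertices `0, …, 8` form the triangulation `gridKlein` after
the centres of the faces and then the remaining vertices have been contracted in the order of
decreasing labels. -/

/-- A quotient of the triangular tiling with 15 vertices.
Walks of length 2 reach 15 vertices from `0`, and 13 vertices from `1`. -/
theorem hasNonTransitiveKleinMap_three_pow_six :
    HasNonTransitiveKleinMap [(3, 6)] :=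
  hasNonTransitiveKleinMap_of_list (n := 15)
    [[1, 13, 14], [1, 4, 14], [1, 12, 13], [0, 1, 4], [0, 1, 8], [1, 8, 12], [3, 6, 11],
     [2, 3, 9], [3, 9, 11], [3, 6, 10], [2, 3, 5], [3, 5, 10], [0, 9, 10], [0, 9, 11], [6, 9, 10],
     [2, 6, 9], [5, 8, 10], [5, 13, 14], [0, 8, 10], [2, 5, 13], [6, 7, 11], [2, 6, 7],
     [7, 12, 13], [2, 7, 13], [8, 12, 14], [5, 8, 14], [4, 7, 11], [0, 4, 11], [4, 7, 12],
     [4, 12, 14]]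
    [14, 4, 4, 4, 8, 12, 7, 12, 7, 7, 2, 0, 13, 8, 6, 10, 11, 10, 5, 5, 10, 11, 2, 6, 8, 0, 0, 12,
     4, 14, 4, 1, 8, 3, 6, 2]
    2 0 1 (by decide +kernel) (by decide +kernel) (by decide +kernel) (by decide +kernel)

/-- A quotient of the hexagonal tiling with 24 vertices.
Walks of length 3 reach 11 vertices from `0`, and 10 vertices from `3`. -/
theorem hasNonTransitiveKleinMap_six_pow_three :
    HasNonTransitiveKleinMap [(6, 3)] :=
  hasNonTransitiveKleinMap_of_list (n := 24)
    [[2, 13, 6, 5, 21, 23], [0, 15, 9, 14, 4, 19], [5, 6, 15, 9, 8, 22], [4, 11, 22, 5, 21, 14],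
     [1, 8, 9, 14, 21, 23], [1, 7, 18, 20, 2, 23], [1, 7, 16, 11, 22, 8], [2, 13, 12, 10, 3, 20],
     [3, 10, 16, 11, 4, 19], [7, 16, 10, 12, 17, 18], [0, 17, 18, 20, 3, 19],
     [0, 15, 6, 13, 12, 17]]
    [17, 0, 12, 10, 3, 16, 7, 1, 11, 6, 4, 5, 1, 8, 14, 18, 0, 2, 6, 7, 0, 4, 3, 7, 10, 4, 0]
    3 0 3 (by decide +kernel) (by decide +kernel) (by decide +kernel) (by decide +kernel)

/-- A quotient of the square tiling with 9 vertices.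
Walks of length 2 reach 7 vertices from `0`, and 9 vertices from `1`. -/
theorem hasNonTransitiveKleinMap_four_pow_four :
    HasNonTransitiveKleinMap [(4, 4)] :=
  hasNonTransitiveKleinMap_of_list (n := 9)
    [[3, 4, 7, 6], [3, 5, 8, 6], [1, 2, 7, 8], [4, 5, 8, 7], [0, 1, 8, 6], [0, 2, 7, 6],
     [1, 2, 3, 5], [0, 1, 5, 4], [0, 2, 3, 4]]
    [0, 4, 2, 2, 0, 8, 7, 5, 7]
    2 0 1 (by decide +kernel) (by decide +kernel) (by decide +kernel) (by decide +kernel)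

/-- A quotient of the elongated triangular tiling with 12 vertices.
Walks of length 2 reach 10 vertices from `0`, and 11 vertices from `1`. -/
theorem hasNonTransitiveKleinMap_three_pow_three_four_pow_two :
    HasNonTransitiveKleinMap [(3, 3), (4, 2)] :=
  hasNonTransitiveKleinMap_of_list (n := 12)
    [[1, 4, 5], [0, 1, 4], [0, 3, 4], [4, 5, 11, 8], [0, 2, 6, 10], [0, 2, 3], [0, 1, 9, 10],
     [1, 2, 6, 9], [1, 2, 5], [7, 8, 10], [6, 8, 10], [6, 8, 11], [2, 3, 5], [3, 5, 11, 7],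
     [7, 9, 11], [6, 9, 11], [3, 4, 8, 7], [7, 9, 10]]
    [7, 7, 9, 9, 11, 2, 11, 8, 8, 2, 9, 1, 2, 6, 8, 3, 0, 1, 6, 8, 7]
    2 0 1 (by decide +kernel) (by decide +kernel) (by decide +kernel) (by decide +kernel)

/-- A quotient of the snub square tiling with 16 vertices.
Walks of length 2 reach 13 vertices from `0`, and 15 vertices from `2`. -/
theorem hasNonTransitiveKleinMap_three_pow_two_four_three_four :
    HasNonTransitiveKleinMap [(3, 2), (4, 1), (3, 1), (4, 1)] :=
  hasNonTransitiveKleinMap_of_list (n := 16)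
    [[9, 10, 15], [0, 10, 15], [0, 4, 7, 10], [7, 10, 12], [2, 7, 12], [0, 1, 11], [1, 2, 7, 11],
     [0, 1, 4], [4, 7, 11], [0, 11, 8, 15], [6, 8, 15], [6, 14, 9, 15], [2, 12, 14, 13],
     [3, 12, 14], [3, 9, 10, 12], [1, 4, 8, 5], [4, 8, 11], [3, 6, 14], [9, 13, 14],
     [3, 6, 5, 13], [2, 5, 13], [1, 2, 5], [5, 6, 8], [3, 9, 13]]
    [13, 5, 5, 5, 5, 9, 6, 8, 5, 3, 14, 13, 14, 6, 8, 11, 4, 1, 0, 12, 12, 4, 15, 15, 9, 6, 2, 6,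
     8, 3, 0]
    2 0 2 (by decide +kernel) (by decide +kernel) (by decide +kernel) (by decide +kernel)

/-- A quotient of the trihexagonal tiling with 27 vertices.
Walks of length 3 reach 24 vertices from `0`, and 25 vertices from `1`. -/
theorem hasNonTransitiveKleinMap_three_six_three_six :
    HasNonTransitiveKleinMap [(3, 1), (6, 1), (3, 1), (6, 1)] :=
  hasNonTransitiveKleinMap_of_list (n := 27)
    [[4, 12, 20, 17, 19, 16], [1, 12, 18, 8, 10, 23], [6, 21, 10, 13, 19, 26],
     [0, 6, 25, 22, 24, 11], [2, 5, 20, 18, 7, 11], [1, 4, 14, 22, 9, 15], [0, 2, 3, 15, 23, 21],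
     [7, 8, 13, 16, 14, 24], [1, 15, 23], [10, 21, 23], [3, 5, 17, 26, 25, 9], [2, 3, 5],
     [3, 9, 15], [9, 22, 25], [7, 8, 18], [8, 10, 13], [13, 16, 19], [0, 6, 21], [0, 2, 11],
     [6, 25, 26], [17, 19, 26], [5, 17, 20], [12, 18, 20], [1, 4, 12], [4, 14, 16], [7, 11, 24],
     [14, 22, 24]]
    [24, 24, 14, 4, 12, 20, 17, 26, 11, 0, 19, 13, 7, 25, 9, 2, 5, 21, 15, 16, 3, 15, 2, 11, 13,
     1, 17, 19, 6, 14, 10, 9, 0, 12, 17, 1, 12, 8, 4, 7, 8, 5, 6, 0, 3]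
    3 0 1 (by decide +kernel) (by decide +kernel) (by decide +kernel) (by decide +kernel)

/-- A quotient of the rhombitrihexagonal tiling with 18 vertices.
Walks of length 3 reach 16 vertices from `0`, and 17 vertices from `1`. -/
theorem hasNonTransitiveKleinMap_three_four_six_four :
    HasNonTransitiveKleinMap [(3, 1), (4, 1), (6, 1), (4, 1)] :=
  hasNonTransitiveKleinMap_of_list (n := 18)
    [[1, 11, 10, 2, 15, 12], [3, 7, 8, 4, 16, 9], [0, 13, 17, 6, 5, 14], [0, 1, 12, 13],
     [4, 14, 15], [0, 8, 4, 14], [0, 1, 8], [4, 15, 12, 16], [2, 5, 14, 15], [2, 3, 5],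
     [1, 8, 7, 11], [3, 5, 6, 7], [12, 13, 16], [9, 16, 13, 17], [2, 3, 9, 10], [6, 7, 11],
     [6, 11, 10, 17], [9, 10, 17]]
    [9, 11, 6, 10, 9, 16, 6, 7, 2, 5, 16, 8, 8, 14, 0, 6, 4, 2, 10, 9, 5, 8, 0, 1, 2, 0, 4]
    3 0 1 (by decide +kernel) (by decide +kernel) (by decide +kernel) (by decide +kernel)

/-- A quotient of the truncated hexagonal tiling with 54 vertices.
Walks of length 6 reach 46 vertices from `0`, and 45 vertices from `1`. -/
theorem hasNonTransitiveKleinMap_three_twelve_pow_two :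
    HasNonTransitiveKleinMap [(3, 1), (12, 2)] :=
  hasNonTransitiveKleinMap_of_list (n := 54)
    [[0, 11, 3, 7, 10, 15, 4, 1, 24, 9, 27, 13], [3, 11, 29, 40, 47, 45, 43, 44, 48, 50, 42, 51],
     [1, 22, 5, 52, 53, 44, 43, 36, 2, 23, 19, 24], [4, 15, 34, 30, 20, 26, 41, 8, 31, 35, 5, 22],
     [6, 32, 42, 51, 7, 10, 34, 30, 18, 16, 17, 33],
     [2, 25, 14, 17, 33, 46, 49, 39, 38, 47, 45, 36], [8, 28, 31],
     [6, 32, 50, 48, 53, 52, 35, 31, 28, 37, 49, 46], [12, 13, 27], [38, 40, 47], [1, 4, 22],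
     [9, 19, 24], [32, 42, 50], [3, 7, 51], [0, 13, 12, 21, 41, 8, 28, 37, 39, 38, 40, 29],
     [10, 15, 34], [2, 23, 25], [9, 19, 23, 25, 14, 16, 18, 20, 26, 21, 12, 27], [44, 48, 53],
     [21, 26, 41], [0, 11, 29], [6, 33, 46], [37, 39, 49], [36, 43, 45], [5, 35, 52],
     [18, 20, 30], [14, 16, 17]]
    [16, 30, 52, 43, 39, 46, 0, 26, 48, 14, 25, 10, 28, 7, 50, 24, 1, 38, 13, 37, 8, 2, 16, 8, 36,
     43, 4, 52, 48, 3, 48, 46, 35, 45, 37, 40, 35, 29, 29, 21, 38, 38, 2, 6, 5, 6, 30, 2, 6, 28,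
     20, 3, 0, 12, 20, 23, 1, 14, 4, 12, 15, 1, 15, 2, 7, 8, 1, 12, 0, 3, 7, 0]
    6 0 1 (by decide +kernel) (by decide +kernel) (by decide +kernel) (by decide +kernel)

/-- A quotient of the truncated square tiling with 24 vertices.
Walks of length 3 reach 10 vertices from `0`, and 11 vertices from `2`. -/
theorem hasNonTransitiveKleinMap_four_eight_pow_two :
    HasNonTransitiveKleinMap [(4, 1), (8, 2)] :=
  hasNonTransitiveKleinMap_of_list (n := 24)
    [[6, 10, 16, 8, 21, 20, 18, 15], [1, 2, 9, 20, 21, 23, 14, 5], [1, 5, 4, 19, 16, 8, 22, 7],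
     [7, 12, 11, 17, 13, 14, 23, 22], [0, 3, 9, 2, 12, 11, 6, 10], [0, 3, 18, 15, 17, 13, 4, 19],
     [0, 10, 16, 19], [1, 2, 12, 7], [8, 21, 23, 22], [6, 11, 17, 15], [4, 5, 14, 13],
     [3, 9, 20, 18]]
    [18, 4, 17, 21, 7, 0, 13, 2, 12, 1, 5, 15, 14, 7, 8, 18, 0, 9, 6, 10, 6, 4, 3, 7, 7, 0, 5]
    3 0 2 (by decide +kernel) (by decide +kernel) (by decide +kernel) (by decide +kernel)

/-- A quotient of the truncated trihexagonal tiling with 36 vertices.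
Walks of length 5 reach 20 vertices from `0`, and 21 vertices from `1`. -/
theorem hasNonTransitiveKleinMap_four_six_twelve :
    HasNonTransitiveKleinMap [(4, 1), (6, 1), (12, 1)] :=
  hasNonTransitiveKleinMap_of_list (n := 36)
    [[0, 2, 26, 28, 31, 29, 21, 27, 14, 32, 30, 25],
     [3, 15, 7, 11, 22, 34, 24, 19, 16, 33, 20, 17], [1, 5, 11, 22], [0, 2, 7, 11, 5, 9],
     [3, 6, 18, 28, 26, 15], [12, 25, 30, 20, 17, 35], [4, 8, 16, 33, 32, 14],
     [1, 13, 27, 21, 34, 22], [10, 19, 24, 29, 31, 23], [8, 10, 19, 16], [4, 13, 27, 14],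
     [1, 5, 9, 12, 35, 6, 18, 23, 10, 8, 4, 13], [0, 9, 12, 25], [2, 7, 15, 26], [20, 30, 32, 33],
     [18, 23, 31, 28], [3, 6, 35, 17], [21, 29, 24, 34]]
    [34, 3, 31, 33, 15, 25, 5, 4, 16, 19, 1, 14, 12, 26, 2, 11, 7, 0, 3, 21, 14, 30, 23, 12, 24,
     23, 13, 15, 12, 19, 10, 11, 1, 14, 1, 10, 12, 8, 6, 4, 1, 3, 1, 8, 3]
    5 0 1 (by decide +kernel) (by decide +kernel) (by decide +kernel) (by decide +kernel)

/-- For each of the ten types there is a semi-equivelar map of that type on the Klein bottle which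
is not vertex-transitive. -/
theorem mainTheorem7 :
    ∀ τ ∈ kleinBottleTypes, ∃ (V : Type) (_ : Finite V) (X : PolyhedralMap V),
      X.IsMapOn KleinBottle ∧ X.IsSemiEquivelarOfType τ ∧ ¬ X.VertexTransitive := by
  simp only [kleinBottleTypes, List.forall_mem_cons, List.not_mem_nil, false_imp_iff, imp_true_iff,
    and_true]
  exact ⟨hasNonTransitiveKleinMap_three_pow_six,
    hasNonTransitiveKleinMap_six_pow_three,
    hasNonTransitiveKleinMap_four_pow_four,
    hasNonTransitiveKleinMap_three_pow_three_four_pow_two,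
    hasNonTransitiveKleinMap_three_pow_two_four_three_four,
    hasNonTransitiveKleinMap_three_six_three_six,
    hasNonTransitiveKleinMap_three_four_six_four,
    hasNonTransitiveKleinMap_three_twelve_pow_two,
    hasNonTransitiveKleinMap_four_eight_pow_two,
    hasNonTransitiveKleinMap_four_six_twelve⟩
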